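/- Let $\mathbb H_{\mathbb Z}=M_2(\mathbb Z)$ with norm $n=\det$, trace $t=\operatorname{tr}$ and $\overline{\begin{pmatrix}a&b\\c&d\end{pmatrix}}=\begin{pmatrix}d&-b\\-c&a\end{pmatrix}$; let $\mathbb B_{\mathbb Z}\subset\mathbb H_{\mathbb Z}$ be the diagonal matrices, and let $\mathbb O_{\mathbb Z}=\mathbb H_{\mathbb Z}\oplus\mathbb H_{\mathbb Z}v$ with $(a+bv)(c+dv)=(ac-\bar d b)+(da+b\bar c)v$, $n(a+bv)=\det a+\det b$, $t(a+bv)=\operatorname{tr}a$, $\overline{a+bv}=\bar a-bv$. For $C$ one of $\mathbb B_{\mathbb Z},\mathbb H_{\mathbb Z},\mathbb O_{\mathbb Z}$ let $\mathcal H_3(C)$ be the lattice of Hermitian matrices $$A=\begin{pmatrix}a&z&\bar y\\ \bar z&b&x\\ y&\bar x&c\end{pmatrix},\qquad a,b,c\in\mathbb Z,\ x,y,z\in C,$$ with cubic form $N(A)=abc-a\,n(x)-b\,n(y)-c\,n(z)+t((xy)z)$ and trace form $(A,A')=aa'+bb'+cc'+t(x\bar x')+t(y\bar y')+t(z\bar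 z')$. On $\mathbb Z\oplus\mathbb Z\oplus\mathbb Z$ put $N(a)=a_1a_2a_3$ and $(a,b)=\sum_i a_ib_i$; this lattice embeds diagonally in $\mathcal H_3(C)$. In all cases the adjoint $A^\#$ is determined by requiring that $(A^\#,B)$ be the coefficient of $s$ in $N(A+sB)$ for all $B$. Let $J$ be one of $\mathbb Z\oplus\mathbb Z\oplus\mathbb Z$, $\mathcal H_3(\mathbb B_{\mathbb Z})$, $\mathcal H_3(\mathbb H_{\mathbb Z})$, $\mathcal H_3(\mathbb O_{\mathbb Z})$, and let $M(J)=\mathbb Z\oplus\mathbb Z\oplus J\oplus J$. For $x=(\alpha,\beta,A,B)$ and $y=(\gamma,\delta,C,D)$ in $M(J)$ put $$\{x,y\}=\alpha\delta-\beta\gamma+(A,D)-(B,C),\qquad q'(x)=-4(A^\#,B^\#)+4\alpha N(A)+4\beta N(B)+\bigl((A,B)-\alpha\beta\bigr)^2,\qquad q=-2q'.$$ Let $q(x,y,z,w)$ be the symmetric four-linear form with $q(x,x,x,x)=q(x)$, let $T(x,x,x)\in M(J)$ be the unique element with $\{T(x,x,x),w\}=q(x,x,x,w)$ for all $w\in M(J)$,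 and let $\gcd T(x,x,x)$ be the greatest integer dividing $T(x,x,x)$ in $M(J)$ (if $T(x,x,x)\neq0$). Let $G_{\mathbb Z}$ be the group of invertible $\mathbb Z$-linear maps of $M(J)$ preserving $q$ and $\{\cdot,\cdot\}$. An element $(\alpha,\beta,(a_1,a_2,a_3),(b_1,b_2,b_3))$ of $M(\mathbb Z\oplus\mathbb Z\oplus\mathbb Z)$ is called projective if, for each $(i,j,k)\in\{(1,2,3),(2,3,1),(3,1,2)\}$, the binary quadratic form $$(\alpha a_i-b_jb_k)X^2+(-a_ib_i+a_jb_j+a_kb_k-\alpha\beta)XY+(\beta b_i-a_ja_k)Y^2$$ is primitive (its three coefficients have greatest common divisor $1$). For $J=\mathcal H_3(C)$, an element of $M(J)$ is called projective if its $G_{\mathbb Z}$-orbit contains an element $(\alpha,\beta,\operatorname{diag}(a_1,a_2,a_3),0)$ with $\alpha,\beta,a_i\in\mathbb Z$, $\alpha>0$, $\alpha\mid\beta$, $\alpha\mid a_1,a_2,a_3$, such that $(\alpha,\beta,(a_1,a_2,a_3),0)$ is projective in $M(\mathbb Z\oplus\mathbb Z\oplus\mathbb Z)$. **Proposition.** Let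 $x\in M(J)$, with $J$ any of the four lattices above. (i) If $\gcd T(x,x,x)=1$, then $x$ is projective. (ii) If $\gcd T(x,x,x)\ge 3$ or $T(x,x,x)=0$, then $x$ is not projective. (iii) If $q'(x)$ is odd, then $\gcd T(x,x,x)=1$ if and only if $x$ is projective. -/

import Mathlib

/-!
# The integral Freudenthal construction and projective elements

Integral split composition rings, their `3 × 3` Hermitian matrices, the module
`M(J) = ℤ ⊕ ℤ ⊕ J ⊕ J` with its symplectic and quartic forms, the group preserving both forms,
the cubic map `x ↦ T(x,x,x)`, and projective elements.
-/

namespace IntegralFreudenthal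

/-! ### Split composition rings over `ℤ` -/

/-- A (not necessarily associative) ring with conjugation, integral trace and integral norm.
The only instances are the three rings below: split binarions, quaternions, octonions. -/
class CompositionRing (C : Type) [NonUnitalNonAssocRing C] where
  /-- conjugation -/
  bar : C → C
  /-- trace -/
  tr : C → ℤ
  /-- the norm, a quadratic form permitting composition -/
  nm : C → ℤ
  nm_mul : ∀ x y, nm (x * y) = nm x * nm y
  bar_add : ∀ x y, bar (x + y) = bar x + bar y
  bar_bar : ∀ x, bar (bar x) = x
  bar_mul : ∀ x y, bar (x * y) = bar y * bar x
  tr_add : ∀ x y, tr (x + y) = tr x + tr y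
  tr_bar : ∀ x, tr (bar x) = tr x
  tr_mul_comm : ∀ x y, tr (x * y) = tr (y * x)
  tr_mul_assoc : ∀ x y z, tr (x * y * z) = tr (x * (y * z))
  nm_add : ∀ x y, nm (x + y) = nm x + tr (x * bar y) + nm y
  tr_mul_bar : ∀ x, tr (x * bar x) = 2 * nm x
  nondeg : ∀ x, (∀ y, tr (x * bar y) = 0) → x = 0

/-- Integral split binarions; `(a, d)` stands for the diagonal matrix `diag(a, d)`, so that the
ring operations are componentwise. -/
abbrev Binarion : Type := ℤ × ℤ

instance : CompositionRing Binarion where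
  bar x := (x.2, x.1)
  tr x := x.1 + x.2
  nm x := x.1 * x.2
  nm_mul x y := by simp; ring
  bar_add x y := rfl
  bar_bar x := rfl
  bar_mul x y := by ext <;> simp [mul_comm]
  tr_add x y := by simp; ring
  tr_bar x := by simp; ring
  tr_mul_comm x y := by simp; ring
  tr_mul_assoc x y z := by simp; ring
  nm_add x y := by simp; ring
  tr_mul_bar x := by simp; ring
  nondeg x h := by
    have h1 := h (1, 0)
    have h2 := h (0, 1)
    simp at h1 h2
    ext <;> simp [h1, h2]

/-- Integral split quaternions: integral `2 × 2` matrices. -/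
abbrev Quaternion : Type := Matrix (Fin 2) (Fin 2) ℤ

instance : CompositionRing Quaternion where
  bar x := !![x 1 1, -x 0 1; -x 1 0, x 0 0]
  tr x := x.trace
  nm x := x.det
  nm_mul x y := Matrix.det_mul x y
  bar_add x y := by
    ext i j; fin_cases i <;> fin_cases j <;> simp <;> ring
  bar_bar x := by
    ext i j; fin_cases i <;> fin_cases j <;> simp
  bar_mul x y := by
    ext i j; fin_cases i <;> fin_cases j <;> simp [Matrix.mul_apply, Fin.sum_univ_two] <;> ring
  tr_add x y := Matrix.trace_add x y
  tr_bar x := by simp [Matrix.trace_fin_two]; ring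
  tr_mul_comm x y := Matrix.trace_mul_comm x y
  tr_mul_assoc x y z := by rw [mul_assoc]
  nm_add x y := by
    simp [Matrix.det_fin_two, Matrix.trace_fin_two, Matrix.mul_apply, Fin.sum_univ_two]; ring
  tr_mul_bar x := by
    simp [Matrix.det_fin_two, Matrix.trace_fin_two, Matrix.mul_apply, Fin.sum_univ_two]; ring
  nondeg x h := by
    have h1 := h !![1, 0; 0, 0]
    have h2 := h !![0, 1; 0, 0]
    have h3 := h !![0, 0; 1, 0]
    have h4 := h !![0, 0; 0, 1]
    simp [Matrix.trace_fin_two, Matrix.mul_apply, Fin.sum_univ_two] at h1 h2 h3 h4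
    ext i j; fin_cases i <;> fin_cases j <;> simp [h1, h2, h3, h4]

open CompositionRing

/-- Integral split octonions `a + b v` with `a`, `b` integral quaternions. -/
@[ext] structure Octonion : Type where
  a : Quaternion
  b : Quaternion

namespace Octonion

/-- The coordinates of an octonion. -/
def equivProd : Octonion ≃ Quaternion × Quaternion where
  toFun x := (x.a, x.b)
  invFun p := ⟨p.1, p.2⟩
  left_inv _ := rfl
  right_inv _ := rfl

instance : AddCommGroup Octonion := equivProd.addCommGroup

/-- `(a + bv)(c + dv) = (ac - d̄b) + (da + bc̄)v`. -/
instance : Mul Octonion :=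
  ⟨fun x y => ⟨x.a * y.a - bar y.b * x.b, y.b * x.a + x.b * bar y.a⟩⟩

@[simp] theorem add_a (x y : Octonion) : (x + y).a = x.a + y.a := rfl
@[simp] theorem add_b (x y : Octonion) : (x + y).b = x.b + y.b := rfl
@[simp] theorem zero_a : (0 : Octonion).a = 0 := rfl
@[simp] theorem zero_b : (0 : Octonion).b = 0 := rfl
@[simp] theorem mul_a (x y : Octonion) : (x * y).a = x.a * y.a - bar y.b * x.b := rfl
@[simp] theorem mul_b (x y : Octonion) : (x * y).b = y.b * x.a + x.b * bar y.a := rfl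

end Octonion

@[simp] theorem bar_zero' {C : Type} [NonUnitalNonAssocRing C] [CompositionRing C] :
    bar (0 : C) = 0 := by
  have h := bar_add (0 : C) 0
  simpa using h

instance : NonUnitalNonAssocRing Octonion where
  __ := (inferInstance : AddCommGroup Octonion)
  __ := (inferInstance : Mul Octonion)
  left_distrib x y z := by
    ext1 <;> simp only [Octonion.mul_a, Octonion.mul_b, Octonion.add_a, Octonion.add_b, bar_add,
      mul_add, add_mul] <;> abel
  right_distrib x y z := by
    ext1 <;> simp only [Octonion.mul_a, Octonion.mul_b, Octonion.add_a, Octonion.add_b,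
      mul_add, add_mul] <;> abel
  zero_mul x := by ext1 <;> simp
  mul_zero x := by ext1 <;> simp

theorem quaternion_bar_00 (x : Quaternion) : bar x 0 0 = x 1 1 := rfl
theorem quaternion_bar_01 (x : Quaternion) : bar x 0 1 = -x 0 1 := rfl
theorem quaternion_bar_10 (x : Quaternion) : bar x 1 0 = -x 1 0 := rfl
theorem quaternion_bar_11 (x : Quaternion) : bar x 1 1 = x 0 0 := rfl
theorem quaternion_tr (x : Quaternion) : tr x = x 0 0 + x 1 1 := Matrix.trace_fin_two x
theorem quaternion_nm (x : Quaternion) : nm x = x 0 0 * x 1 1 - x 0 1 * x 1 0 :=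
  Matrix.det_fin_two x

instance : CompositionRing Octonion where
  bar x := ⟨bar x.a, -x.b⟩
  tr x := tr x.a
  nm x := nm x.a + nm x.b
  nm_mul x y := by
    simp [quaternion_bar_00, quaternion_bar_01, quaternion_bar_10,
      quaternion_bar_11, quaternion_nm, Matrix.mul_apply, Fin.sum_univ_two]; ring
  bar_add x y := by
    ext1
    · simp [bar_add]
    · simp; abel
  bar_bar x := by ext1 <;> simp [bar_bar]
  bar_mul x y := by
    ext1 <;> ext i j <;> fin_cases i <;> fin_cases j <;>
      simp [quaternion_bar_00, quaternion_bar_01, quaternion_bar_10,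
      quaternion_bar_11, Matrix.mul_apply, Fin.sum_univ_two] <;> ring
  tr_add x y := by simp [tr_add]
  tr_bar x := tr_bar x.a
  tr_mul_comm x y := by
    simp [quaternion_bar_00, quaternion_bar_01, quaternion_bar_10,
      quaternion_bar_11, quaternion_tr, Matrix.mul_apply, Fin.sum_univ_two]; ring
  tr_mul_assoc x y z := by
    simp [quaternion_bar_00, quaternion_bar_01, quaternion_bar_10,
      quaternion_bar_11, quaternion_tr, Matrix.mul_apply, Fin.sum_univ_two]; ring
  nm_add x y := by
    simp [quaternion_bar_00, quaternion_bar_01, quaternion_bar_10,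
      quaternion_bar_11, quaternion_tr, quaternion_nm, Matrix.mul_apply, Fin.sum_univ_two]; ring
  tr_mul_bar x := by
    simp [quaternion_bar_00, quaternion_bar_01, quaternion_bar_10, quaternion_bar_11,
      quaternion_tr, quaternion_nm, Matrix.mul_apply, Fin.sum_univ_two]; ring
  nondeg x h := by
    have ha : x.a = 0 := nondeg x.a fun y => by simpa using h ⟨y, 0⟩
    have hb : x.b = 0 := by
      refine nondeg x.b fun y => ?_
      have := h ⟨0, y⟩
      simp [quaternion_bar_00, quaternion_bar_01, quaternion_bar_10,
      quaternion_bar_11, quaternion_tr, Matrix.mul_apply, Fin.sum_univ_two] at this ⊢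
      linarith
    ext1 <;> assumption

/-! ### Cubic lattices: `ℤ ⊕ ℤ ⊕ ℤ` and Hermitian matrices -/

/-- A lattice with a cubic form `N`, its adjoint map `#` and its trace bilinear form `(·,·)`.
The only instances are `ℤ ⊕ ℤ ⊕ ℤ` and the lattices of `3 × 3` Hermitian matrices below. -/
class CubicLattice (J : Type) [AddCommGroup J] where
  /-- the cubic form -/
  N : J → ℤ
  /-- the adjoint (sharp) map -/
  sharp : J → J
  /-- the trace bilinear form -/
  bil : J → J → ℤ
  bil_add : ∀ x y z, bil (x + y) z = bil x z + bil y z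
  bil_comm : ∀ x y, bil x y = bil y x
  bil_nondeg : ∀ x, (∀ y, bil x y = 0) → x = 0
  N_smul : ∀ (k : ℤ) x, N (k • x) = k ^ 3 * N x
  sharp_smul : ∀ (k : ℤ) x, sharp (k • x) = k ^ 2 • sharp x
  N_add : ∀ x y, N (x + y) = N x + bil (sharp x) y + bil x (sharp y) + N y

open CubicLattice

/-- The lattice `ℤ ⊕ ℤ ⊕ ℤ`. -/
abbrev Diag : Type := Fin 3 → ℤ

instance : CubicLattice Diag where
  N a := a 0 * a 1 * a 2
  sharp a := ![a 1 * a 2, a 2 * a 0, a 0 * a 1]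
  bil a b := a 0 * b 0 + a 1 * b 1 + a 2 * b 2
  bil_add x y z := by simp; ring
  bil_comm x y := by ring
  bil_nondeg x h := by
    have h0 := h ![1, 0, 0]
    have h1 := h ![0, 1, 0]
    have h2 := h ![0, 0, 1]
    simp at h0 h1 h2
    ext i; fin_cases i <;> simp [h0, h1, h2]
  N_smul k x := by simp; ring
  sharp_smul k x := by ext i; fin_cases i <;> simp <;> ring
  N_add x y := by simp; ring

/-- The `3 × 3` Hermitian matrix with rows `(a, z, ȳ)`, `(z̄, b, x)`, `(y, x̄, c)`. -/
@[ext] structure Herm (C : Type) : Type where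
  a : ℤ
  b : ℤ
  c : ℤ
  x : C
  y : C
  z : C

namespace Herm

variable {C : Type} [NonUnitalNonAssocRing C]

/-- The coordinates of a Hermitian matrix. -/
def equivProd (C : Type) : Herm C ≃ ℤ × ℤ × ℤ × C × C × C where
  toFun A := (A.a, A.b, A.c, A.x, A.y, A.z)
  invFun p := ⟨p.1, p.2.1, p.2.2.1, p.2.2.2.1, p.2.2.2.2.1, p.2.2.2.2.2⟩
  left_inv _ := rfl
  right_inv _ := rfl

instance : AddCommGroup (Herm C) := (equivProd C).addCommGroup

@[simp] theorem add_a (A B : Herm C) : (A + B).a = A.a + B.a := rfl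
@[simp] theorem add_b (A B : Herm C) : (A + B).b = A.b + B.b := rfl
@[simp] theorem add_c (A B : Herm C) : (A + B).c = A.c + B.c := rfl
@[simp] theorem add_x (A B : Herm C) : (A + B).x = A.x + B.x := rfl
@[simp] theorem add_y (A B : Herm C) : (A + B).y = A.y + B.y := rfl
@[simp] theorem add_z (A B : Herm C) : (A + B).z = A.z + B.z := rfl
@[simp] theorem zero_a : (0 : Herm C).a = 0 := rfl
@[simp] theorem zero_b : (0 : Herm C).b = 0 := rfl
@[simp] theorem zero_c : (0 : Herm C).c = 0 := rfl
@[simp] theorem zero_x : (0 : Herm C).x = 0 := rfl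
@[simp] theorem zero_y : (0 : Herm C).y = 0 := rfl
@[simp] theorem zero_z : (0 : Herm C).z = 0 := rfl
@[simp] theorem smul_a (k : ℤ) (A : Herm C) : (k • A).a = k * A.a := rfl
@[simp] theorem smul_b (k : ℤ) (A : Herm C) : (k • A).b = k * A.b := rfl
@[simp] theorem smul_c (k : ℤ) (A : Herm C) : (k • A).c = k * A.c := rfl
@[simp] theorem smul_x (k : ℤ) (A : Herm C) : (k • A).x = k • A.x := rfl
@[simp] theorem smul_y (k : ℤ) (A : Herm C) : (k • A).y = k • A.y := rfl
@[simp] theorem smul_z (k : ℤ) (A : Herm C) : (k • A).z = k • A.z := rfl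

end Herm

section laws

variable {C : Type} [NonUnitalNonAssocRing C] [CompositionRing C]

theorem bar_zsmul (k : ℤ) (x : C) : bar (k • x) = k • bar x :=
  map_zsmul (AddMonoidHom.mk' (bar : C → C) bar_add) k x

theorem bar_sub (x y : C) : bar (x - y) = bar x - bar y :=
  map_sub (AddMonoidHom.mk' (bar : C → C) bar_add) x y

theorem tr_zsmul (k : ℤ) (x : C) : tr (k • x) = k * tr x := by
  simpa using map_zsmul (AddMonoidHom.mk' (tr : C → ℤ) tr_add) k x

theorem tr_zero' : tr (0 : C) = 0 := by simpa using tr_add (0 : C) 0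

theorem tr_sub (x y : C) : tr (x - y) = tr x - tr y :=
  map_sub (AddMonoidHom.mk' (tr : C → ℤ) tr_add) x y

theorem tr_mul_bar_comm (x y : C) : tr (x * bar y) = tr (y * bar x) := by
  rw [← tr_bar, CompositionRing.bar_mul, bar_bar]

theorem nm_zsmul (k : ℤ) (x : C) : nm (k • x) = k ^ 2 * nm x := by
  have h := tr_mul_bar (k • x)
  rw [bar_zsmul, smul_mul_smul_comm, tr_zsmul, tr_mul_bar] at h
  linarith

theorem tr_bar_bar_bar (x y z : C) : tr (bar x * bar y * bar z) = tr (z * (y * x)) := by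
  rw [← CompositionRing.bar_mul, ← CompositionRing.bar_mul, tr_bar]

end laws

instance {C : Type} [NonUnitalNonAssocRing C] [CompositionRing C] : CubicLattice (Herm C) where
  N A := A.a * A.b * A.c - A.a * nm A.x - A.b * nm A.y - A.c * nm A.z + tr (A.x * A.y * A.z)
  sharp A :=
    { a := A.b * A.c - nm A.x
      b := A.a * A.c - nm A.y
      c := A.a * A.b - nm A.z
      x := bar A.z * bar A.y - A.a • A.x
      y := bar A.x * bar A.z - A.b • A.y
      z := bar A.y * bar A.x - A.c • A.z }
  bil A B := A.a * B.a + A.b * B.b + A.c * B.c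
    + tr (A.x * bar B.x) + tr (A.y * bar B.y) + tr (A.z * bar B.z)
  bil_add A B D := by simp [add_mul, tr_add]; ring
  bil_comm A B := by
    rw [tr_mul_bar_comm A.x, tr_mul_bar_comm A.y, tr_mul_bar_comm A.z]; ring
  bil_nondeg A h := by
    have h1 := h ⟨1, 0, 0, 0, 0, 0⟩
    have h2 := h ⟨0, 1, 0, 0, 0, 0⟩
    have h3 := h ⟨0, 0, 1, 0, 0, 0⟩
    have hx : A.x = 0 := nondeg A.x fun y => by
      simpa [tr_zero'] using h ⟨0, 0, 0, y, 0, 0⟩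
    have hy : A.y = 0 := nondeg A.y fun y => by
      simpa [tr_zero'] using h ⟨0, 0, 0, 0, y, 0⟩
    have hz : A.z = 0 := nondeg A.z fun y => by
      simpa [tr_zero'] using h ⟨0, 0, 0, 0, 0, y⟩
    simp [tr_zero'] at h1 h2 h3
    ext1 <;> assumption
  N_smul k A := by
    simp only [Herm.smul_a, Herm.smul_b, Herm.smul_c, Herm.smul_x, Herm.smul_y, Herm.smul_z,
      nm_zsmul, smul_mul_smul_comm, tr_zsmul]
    ring
  sharp_smul k A := by
    ext1 <;> simp only [Herm.smul_a, Herm.smul_b, Herm.smul_c, Herm.smul_x, Herm.smul_y,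
      Herm.smul_z, nm_zsmul, bar_zsmul, smul_mul_smul_comm, smul_sub, smul_smul]
    · ring
    · ring
    · ring
    all_goals congr 2 <;> ring
  N_add A B := by
    simp only [Herm.add_a, Herm.add_b, Herm.add_c, Herm.add_x, Herm.add_y, Herm.add_z,
      nm_add, add_mul, mul_add, sub_mul, mul_sub, bar_sub, bar_zsmul, CompositionRing.bar_mul,
      bar_bar, tr_add, tr_sub, smul_mul_assoc, mul_smul_comm, tr_zsmul, tr_bar_bar_bar]
    have e1 := tr_mul_assoc B.x A.y A.z
    have e2 : tr (B.y * (A.z * A.x)) = tr (A.x * B.y * A.z) := by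
      rw [← tr_mul_assoc, tr_mul_comm, ← tr_mul_assoc]
    have e3 := tr_mul_comm B.z (A.x * A.y)
    have e4 := tr_mul_assoc A.x B.y B.z
    have e5 : tr (A.y * (B.z * B.x)) = tr (B.x * A.y * B.z) := by
      rw [← tr_mul_assoc, tr_mul_comm, ← tr_mul_assoc]
    have e6 := tr_mul_comm A.z (B.x * B.y)
    linear_combination e1 - e2 - e3 + e4 - e5 - e6

/-- The diagonal embedding of `ℤ ⊕ ℤ ⊕ ℤ` into the Hermitian matrices. -/
def Herm.diag {C : Type} [NonUnitalNonAssocRing C] (a : Diag) : Herm C :=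
  ⟨a 0, a 1, a 2, 0, 0, 0⟩

section cubic

variable {J : Type} [AddCommGroup J] [CubicLattice J]

/-- The linearization `x × y` of the sharp map. -/
def cross (x y : J) : J := sharp (x + y) - sharp x - sharp y

theorem sharp_add (x y : J) : sharp (x + y) = sharp x + cross x y + sharp y := by
  unfold cross; abel

theorem cross_comm (x y : J) : cross x y = cross y x := by
  unfold cross; rw [add_comm x y]; abel

theorem bil_add_right (x y z : J) : bil x (y + z) = bil x y + bil x z := by
  rw [bil_comm, bil_add, bil_comm y, bil_comm z]

theorem bil_smul (k : ℤ) (x y : J) : bil (k • x) y = k * bil x y := by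
  simpa using map_zsmul (AddMonoidHom.mk' (fun x : J => bil x y) fun a b => bil_add a b y) k x

theorem bil_smul_right (k : ℤ) (x y : J) : bil x (k • y) = k * bil x y := by
  rw [bil_comm, bil_smul, bil_comm]

theorem bil_neg (x y : J) : bil (-x) y = -bil x y := by
  simpa using bil_smul (-1) x y

theorem bil_sub (x y z : J) : bil (x - y) z = bil x z - bil y z := by
  rw [sub_eq_add_neg, bil_add, bil_neg]; ring

theorem bil_cross (x y z : J) : bil (cross x y) z = bil x (cross y z) := by
  have h : N (x + y + z) = N (x + (y + z)) := by rw [add_assoc]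
  rw [N_add (x + y) z, N_add x y, N_add x (y + z), N_add y z, sharp_add, sharp_add] at h
  simp only [bil_add, bil_add_right] at h
  linarith

theorem bil_ext {x y : J} (h : ∀ z, bil x z = bil y z) : x = y :=
  sub_eq_zero.mp (bil_nondeg _ fun z => by rw [bil_sub, h z, sub_self])

theorem cross_smul (k : ℤ) (x y : J) : cross (k • x) y = k • cross x y :=
  bil_ext fun z => by rw [bil_cross, bil_smul, bil_smul, bil_cross]

theorem bil_sharp_self (x : J) : bil (sharp x) x = 3 * N x := by
  have h := N_add x x
  rw [← two_zsmul, N_smul, bil_comm x] at h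
  linarith

theorem cross_self (x : J) : cross x x = (2 : ℤ) • sharp x := by
  unfold cross; rw [← two_zsmul, sharp_smul, sub_sub, ← two_zsmul, ← sub_smul]; norm_num

end cubic

/-! ### The Freudenthal module -/

/-- `M(J) = ℤ ⊕ ℤ ⊕ J ⊕ J`, with elements `(α, β, A, B)`. -/
@[ext] structure Freudenthal (J : Type) : Type where
  α : ℤ
  β : ℤ
  A : J
  B : J

namespace Freudenthal

/-- The coordinates of an element of `M(J)`. -/
def equivProd (J : Type) : Freudenthal J ≃ ℤ × ℤ × J × J where
  toFun x := (x.α, x.β, x.A, x.B)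
  invFun p := ⟨p.1, p.2.1, p.2.2.1, p.2.2.2⟩
  left_inv _ := rfl
  right_inv _ := rfl

variable {J : Type} [AddCommGroup J]

instance : AddCommGroup (Freudenthal J) := (equivProd J).addCommGroup

@[simp] theorem add_α (x y : Freudenthal J) : (x + y).α = x.α + y.α := rfl
@[simp] theorem add_β (x y : Freudenthal J) : (x + y).β = x.β + y.β := rfl
@[simp] theorem add_A (x y : Freudenthal J) : (x + y).A = x.A + y.A := rfl
@[simp] theorem add_B (x y : Freudenthal J) : (x + y).B = x.B + y.B := rfl
@[simp] theorem smul_α (k : ℤ) (x : Freudenthal J) : (k • x).α = k * x.α := rfl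
@[simp] theorem smul_β (k : ℤ) (x : Freudenthal J) : (k • x).β = k * x.β := rfl
@[simp] theorem smul_A (k : ℤ) (x : Freudenthal J) : (k • x).A = k • x.A := rfl
@[simp] theorem smul_B (k : ℤ) (x : Freudenthal J) : (k • x).B = k • x.B := rfl

variable [CubicLattice J]

/-- The symplectic form `{x, y}`. -/
def symp (x y : Freudenthal J) : ℤ :=
  x.α * y.β - x.β * y.α + bil x.A y.B - bil x.B y.A

/-- The quartic form `q`. -/
def q (x : Freudenthal J) : ℤ :=
  8 * bil (sharp x.A) (sharp x.B) - 8 * x.α * N x.A - 8 * x.β * N x.B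
    - 2 * (bil x.A x.B - x.α * x.β) ^ 2

/-- The modified quartic form `q'`, with `q = -2 q'`. -/
def q' (x : Freudenthal J) : ℤ :=
  -4 * bil (sharp x.A) (sharp x.B) + 4 * x.α * N x.A + 4 * x.β * N x.B
    + (bil x.A x.B - x.α * x.β) ^ 2

/-- The symmetric four-linear form `q(x, y, z, w)` with `q(x, x, x, x) = q(x)`: the full
polarization of `q`, divided by `4! = 24`. -/
def qLin (x y z w : Freudenthal J) : ℚ :=
  (q (x + y + z + w)
    - q (x + y + z) - q (x + y + w) - q (x + z + w) - q (y + z + w)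
    + q (x + y) + q (x + z) + q (x + w) + q (y + z) + q (y + w) + q (z + w)
    - q x - q y - q z - q w : ℤ) / 24

theorem symp_add_left (x y z : Freudenthal J) : symp (x + y) z = symp x z + symp y z := by
  simp only [symp, add_α, add_β, add_A, add_B, bil_add]; ring

theorem symp_ext {s t : Freudenthal J} (h : ∀ w, symp s w = symp t w) : s = t := by
  have h1 := h ⟨1, 0, 0, 0⟩
  have h2 := h ⟨0, 1, 0, 0⟩
  have z : ∀ u : J, bil u 0 = 0 := fun u => by simpa using bil_smul_right 0 u 0
  simp [symp, z] at h1 h2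
  ext1
  · exact h2
  · exact h1
  · exact bil_ext fun d => by simpa [symp, z] using h ⟨0, 0, 0, d⟩
  · exact bil_ext fun d => by simpa [symp, z] using h ⟨0, 0, d, 0⟩

theorem q_smul_add (k : ℤ) (x w : Freudenthal J) :
    q (k • x + w) =
      8 * (k ^ 4 * bil (sharp x.A) (sharp x.B)
        + k ^ 3 * (bil (sharp x.A) (cross x.B w.B) + bil (cross x.A w.A) (sharp x.B))
        + k ^ 2 * (bil (sharp x.A) (sharp w.B) + bil (cross x.A w.A) (cross x.B w.B)
          + bil (sharp w.A) (sharp x.B))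
        + k * (bil (cross x.A w.A) (sharp w.B) + bil (sharp w.A) (cross x.B w.B))
        + bil (sharp w.A) (sharp w.B))
      - 8 * (k * x.α + w.α) * (k ^ 3 * N x.A + k ^ 2 * bil (sharp x.A) w.A
        + k * bil x.A (sharp w.A) + N w.A)
      - 8 * (k * x.β + w.β) * (k ^ 3 * N x.B + k ^ 2 * bil (sharp x.B) w.B
        + k * bil x.B (sharp w.B) + N w.B)
      - 2 * (k ^ 2 * bil x.A x.B + k * (bil x.A w.B + bil w.A x.B) + bil w.A w.B
        - (k * x.α + w.α) * (k * x.β + w.β)) ^ 2 := by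
  simp only [q, add_α, add_β, add_A, add_B, smul_α, smul_β, smul_A, smul_B, N_add, sharp_add,
    N_smul, sharp_smul, cross_smul, bil_add, bil_add_right, bil_smul, bil_smul_right]
  ring

/-- An explicit solution `t` of the equations `{t, w} = q(x, x, x, w)` for all `w`. -/
def tFormula (x : Freudenthal J) : Freudenthal J where
  α := -x.α ^ 2 * x.β + x.α * bil x.A x.B - 2 * N x.B
  β := x.α * x.β ^ 2 - x.β * bil x.A x.B + 2 * N x.A
  A := (2 : ℤ) • cross x.B (sharp x.A) - (2 * x.β) • sharp x.B
    - (bil x.A x.B - x.α * x.β) • x.A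
  B := (2 * x.α) • sharp x.A - (2 : ℤ) • cross x.A (sharp x.B)
    + (bil x.A x.B - x.α * x.β) • x.B

theorem symp_tFormula (x w : Freudenthal J) : (symp (tFormula x) w : ℚ) = qLin x x x w := by
  have key : q (x + x + x + w) - q (x + x + x) - q (x + x + w) - q (x + x + w) - q (x + x + w)
      + q (x + x) + q (x + x) + q (x + w) + q (x + x) + q (x + w) + q (x + w)
      - q x - q x - q x - q w = 24 * symp (tFormula x) w := by
    have e2 : x + x = (2 : ℤ) • x := (two_zsmul x).symm
    have e3 : x + x + x = (3 : ℤ) • x := by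
      rw [e2]; simpa using (add_smul (2 : ℤ) 1 x).symm
    have c : ∀ k : ℤ, q (k • x) = k ^ 4 * q x := fun k => by
      simp only [q, smul_α, smul_β, smul_A, smul_B, N_smul, sharp_smul, bil_smul, bil_smul_right]
      ring
    have b1 : bil (cross x.B (sharp x.A)) w.B = bil (sharp x.A) (cross x.B w.B) := by
      rw [cross_comm, bil_cross]
    have b2 : bil (cross x.A (sharp x.B)) w.A = bil (cross x.A w.A) (sharp x.B) := by
      rw [cross_comm, bil_cross, bil_comm]
    have b3 : bil x.B w.A = bil w.A x.B := bil_comm _ _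
    have h1 : q (x + w) = q ((1 : ℤ) • x + w) := by rw [one_smul]
    rw [e3, e2, c, c, h1, q_smul_add, q_smul_add, q_smul_add]
    simp only [symp, tFormula, bil_add, bil_sub, bil_smul, b1, b2, b3, q]
    ring
  rw [qLin, key]
  push_cast
  ring

/-- There is exactly one `t` in `M(J)` with `{t, w} = q(x, x, x, w)` for all `w`. -/
theorem existsUnique_T (x : Freudenthal J) :
    ∃! t : Freudenthal J, ∀ w, (symp t w : ℚ) = qLin x x x w :=
  ⟨tFormula x, symp_tFormula x, fun t ht => symp_ext fun w => by
    exact_mod_cast (ht w).trans (symp_tFormula x w).symm⟩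

/-- `T(x, x, x)`: the unique element of `M(J)` with `{T(x, x, x), w} = q(x, x, x, w)` for
all `w`. -/
noncomputable def T (x : Freudenthal J) : Freudenthal J := (existsUnique_T x).choose

theorem T_eq_tFormula (x : Freudenthal J) : T x = tFormula x :=
  symp_ext fun w => by
    exact_mod_cast ((existsUnique_T x).choose_spec.1 w).trans (symp_tFormula x w).symm

/-- The greatest integer dividing an element of a free `ℤ`-module (`0` for the zero element,
which every integer divides). -/
noncomputable def gcd (x : Freudenthal J) : ℕ := sSup {d : ℕ | ∃ y : Freudenthal J, x = d • y}

variable (J) in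
/-- The group of invertible `ℤ`-linear transformations of `M(J)` preserving `q` and `{·,·}`. -/
def group : Subgroup (Freudenthal J ≃ₗ[ℤ] Freudenthal J) where
  carrier := {σ | (∀ x y, symp (σ x) (σ y) = symp x y) ∧ ∀ x, q (σ x) = q x}
  mul_mem' := fun {σ τ} hσ hτ =>
    ⟨fun x y => (hσ.1 (τ x) (τ y)).trans (hτ.1 x y), fun x => (hσ.2 (τ x)).trans (hτ.2 x)⟩
  one_mem' := ⟨fun _ _ => rfl, fun _ => rfl⟩
  inv_mem' := fun {σ} hσ =>
    ⟨fun x y => by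
      have h := hσ.1 (σ.symm x) (σ.symm y)
      rw [σ.apply_symm_apply, σ.apply_symm_apply] at h
      exact h.symm,
    fun x => by
      have h := hσ.2 (σ.symm x)
      rw [σ.apply_symm_apply] at h
      exact h.symm⟩

/-! ### Projective elements -/

/-- The binary quadratic form `a x² + b x y + c y²` is primitive. -/
def PrimitiveForm (a b c : ℤ) : Prop := Int.gcd (Int.gcd a b) c = 1

/-- Projective elements of `M(ℤ ⊕ ℤ ⊕ ℤ)`: the three associated binary quadratic forms are
primitive. -/
def IsProjectiveDiag (x : Freudenthal Diag) : Prop :=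
  PrimitiveForm (x.α * x.A 0 - x.B 1 * x.B 2)
      (-(x.A 0 * x.B 0) + x.A 1 * x.B 1 + x.A 2 * x.B 2 - x.α * x.β)
      (x.β * x.B 0 - x.A 1 * x.A 2) ∧
    PrimitiveForm (x.α * x.A 1 - x.B 2 * x.B 0)
      (x.A 0 * x.B 0 - x.A 1 * x.B 1 + x.A 2 * x.B 2 - x.α * x.β)
      (x.β * x.B 1 - x.A 2 * x.A 0) ∧
    PrimitiveForm (x.α * x.A 2 - x.B 0 * x.B 1)
      (x.A 0 * x.B 0 + x.A 1 * x.B 1 - x.A 2 * x.B 2 - x.α * x.β)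
      (x.β * x.B 2 - x.A 0 * x.A 1)

/-- Projective elements of `M(J)`, `J` the Hermitian matrices over a composition ring: the orbit
contains a diagonal reduced element `(α, β, diag(a₁, a₂, a₃), 0)`, where `α > 0` divides `β` and
all `aᵢ`, such that `(α, β, (a₁, a₂, a₃), 0)` is projective in `M(ℤ ⊕ ℤ ⊕ ℤ)`. -/
def IsProjective {C : Type} [NonUnitalNonAssocRing C] [CompositionRing C]
    (x : Freudenthal (Herm C)) : Prop :=
  ∃ (α β : ℤ) (a : Diag), 0 < α ∧ α ∣ β ∧ (∀ i, α ∣ a i) ∧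
    (∃ σ ∈ group (Herm C), σ x = ⟨α, β, Herm.diag a, 0⟩) ∧
    IsProjectiveDiag ⟨α, β, a, 0⟩

end Freudenthal

end IntegralFreudenthal

/-! Everything is read off from the divisors of `T(x,x,x)`. Divisibility of `T` by `d` is constant
on orbits, because `T` is defined by the two forms that the group preserves (`tFormula_map`).

On `M(ℤ ⊕ ℤ ⊕ ℤ)` each of the three binary forms `uX² + vXY + wY²` has discriminant `v² - 4uw = q'`,
and the coordinates of `T` are, up to sign, half the partial derivatives of `q'`, that is, `v ∂v -
2u ∂w - 2w ∂u`. A common divisor of `u, v, w` therefore divides `T`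
(`isProjectiveDiag_of_forall_dvdT`). Conversely, twice any product of a coefficient of one form and
a coefficient of another is a combination of coordinates of `T`, so by Bézout primitive forms leave
only divisors of 2 (`IsProjectiveDiag.dvd_two`). An odd `q'` excludes 2 itself (`not_two_dvdT`).

For Hermitian matrices `T` commutes with the diagonal embedding, so the bound by 2 carries over.
What remains is a reduction theorem: if only 1 divides `T`, the orbit contains some `(1, β, diag a,
0)` (`exists_equivalent_diag`). An orbit element with `|α|` nonzero and least has `α` dividing `A`
and `B`, hence dividing `T`, so `α = ±1`; a translation then clears `B`, and a norm-preserving map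
diagonalizes `A` (`exists_congruent_diag`). Both reductions are Euclidean descents, and besides the
composition laws their only input about `C` is `IsotropicallyDetected`. That all unipotent maps
preserve `q` is checked on multiples of one idempotent and spread by conjugation
(`mem_translations`). -/

namespace IntegralFreudenthal
open CompositionRing CubicLattice

/-! ### Formal consequences of the cubic laws; norm-preserving dual pairs. -/

section cubicLaws

variable {J : Type} [AddCommGroup J] [CubicLattice J]

theorem bil_zero_right (x : J) : bil x 0 = 0 := by simpa using bil_smul_right 0 x 0

theorem bil_zero_left (x : J) : bil 0 x = 0 := by rw [bil_comm, bil_zero_right]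

theorem bil_neg_right (x y : J) : bil x (-y) = -bil x y := by rw [bil_comm, bil_neg, bil_comm]

theorem cross_add_left (x y z : J) : cross (x + y) z = cross x z + cross y z :=
  bil_ext fun w => by simp only [bil_cross, bil_add]

theorem cross_add_right (x y z : J) : cross x (y + z) = cross x y + cross x z := by
  rw [cross_comm, cross_add_left, cross_comm y, cross_comm z]

theorem cross_smul_right (k : ℤ) (x y : J) : cross x (k • y) = k • cross x y := by
  rw [cross_comm, cross_smul, cross_comm]

theorem sharp_neg (x : J) : sharp (-x) = sharp x := by simpa using sharp_smul (-1) x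

theorem sharp_zero : sharp (0 : J) = 0 := by simpa using sharp_smul 0 (0 : J)

theorem N_neg (x : J) : N (-x) = -N x := by simpa using N_smul (-1) x

theorem N_zero : N (0 : J) = 0 := by simpa using N_smul 0 (0 : J)

theorem cross_zero_left (x : J) : cross 0 x = 0 := by simpa using cross_smul 0 (0 : J) x

theorem cross_zero_right (x : J) : cross x 0 = 0 := by rw [cross_comm, cross_zero_left]

theorem N_eq_zero_of_sharp_eq_zero {x : J} (h : sharp x = 0) : N x = 0 := by
  have := bil_sharp_self x
  rw [h, bil_zero_left] at this
  omega

/-- A pair of bijections of `J` that both preserve the norm and are dual to each other under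
the trace form. -/
structure IsNormPair (g g' : J → J) : Prop where
  bil_map : ∀ x y, bil (g x) (g' y) = bil x y
  N_left : ∀ x, N (g x) = N x
  N_right : ∀ x, N (g' x) = N x
  surj_left : Function.Surjective g
  surj_right : Function.Surjective g'

namespace IsNormPair

variable {g g' h h' : J → J}

theorem symm (P : IsNormPair g g') : IsNormPair g' g :=
  ⟨fun x y => by rw [bil_comm, P.bil_map, bil_comm], P.N_right, P.N_left, P.surj_right,
    P.surj_left⟩

theorem comp (P : IsNormPair g g') (Q : IsNormPair h h') : IsNormPair (g ∘ h) (g' ∘ h') :=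
  ⟨fun x y => by simp [P.bil_map, Q.bil_map], fun x => by simp [P.N_left, Q.N_left],
    fun x => by simp [P.N_right, Q.N_right], P.surj_left.comp Q.surj_left,
    P.surj_right.comp Q.surj_right⟩

theorem id : IsNormPair (id : J → J) id :=
  ⟨fun _ _ => rfl, fun _ => rfl, fun _ => rfl, Function.surjective_id, Function.surjective_id⟩

/-- Linearity is not part of the structure: it is forced by duality, nondegeneracy of the trace form
and surjectivity of `g'`. -/
theorem map_add (P : IsNormPair g g') (x y : J) : g (x + y) = g x + g y :=
  bil_ext fun z => by
    obtain ⟨w, rfl⟩ := P.surj_right z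
    rw [bil_add, P.bil_map, P.bil_map, P.bil_map, bil_add]

theorem map_neg (P : IsNormPair g g') (x : J) : g (-x) = -g x :=
  _root_.map_neg (AddMonoidHom.mk' g P.map_add) x

theorem map_smul (P : IsNormPair g g') (k : ℤ) (x : J) : g (k • x) = k • g x :=
  map_zsmul (AddMonoidHom.mk' g P.map_add) k x

theorem sharp_map (P : IsNormPair g g') (x : J) : sharp (g x) = g' (sharp x) :=
  bil_ext fun z => by
    obtain ⟨y, rfl⟩ := P.surj_left z
    -- Adding the expansions of `N (x + y)` and `N (-x + y)` cancels the terms odd in `x` and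
    -- isolates `bil (sharp x) y`.
    have h1 := N_add (g x) (g y)
    have h2 := N_add (-g x) (g y)
    rw [← P.map_neg, ← P.map_add, P.N_left, P.N_left, P.N_left, N_add, P.map_neg, bil_neg,
      bil_neg, sharp_neg, sharp_neg] at h2
    rw [← P.map_add, P.N_left, P.N_left, P.N_left, N_add] at h1
    rw [P.symm.bil_map]
    linarith

theorem cross_map (P : IsNormPair g g') (x y : J) : cross (g x) (g y) = g' (cross x y) := by
  unfold cross
  rw [← P.map_add, P.sharp_map, P.sharp_map, P.sharp_map, sub_eq_add_neg, sub_eq_add_neg,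
    sub_eq_add_neg, sub_eq_add_neg, P.symm.map_add, P.symm.map_add, P.symm.map_neg,
    P.symm.map_neg]

end IsNormPair

end cubicLaws

/-! ### Orbits in `M(J)`. -/

namespace Freudenthal

variable {J : Type} [AddCommGroup J]

@[simp] theorem zero_α : (0 : Freudenthal J).α = 0 := rfl
@[simp] theorem zero_β : (0 : Freudenthal J).β = 0 := rfl
@[simp] theorem zero_A : (0 : Freudenthal J).A = 0 := rfl
@[simp] theorem zero_B : (0 : Freudenthal J).B = 0 := rfl
@[simp] theorem neg_α (x : Freudenthal J) : (-x).α = -x.α := rfl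
@[simp] theorem neg_β (x : Freudenthal J) : (-x).β = -x.β := rfl
@[simp] theorem neg_A (x : Freudenthal J) : (-x).A = -x.A := rfl
@[simp] theorem neg_B (x : Freudenthal J) : (-x).B = -x.B := rfl

variable [CubicLattice J]

/-- Two elements lie in the same orbit of the group preserving `q` and `{·,·}`. -/
def Equivalent (x y : Freudenthal J) : Prop := ∃ σ ∈ group J, σ x = y

theorem Equivalent.refl (x : Freudenthal J) : Equivalent x x := ⟨1, one_mem _, rfl⟩

theorem Equivalent.trans {x y z : Freudenthal J} (h : Equivalent x y) (k : Equivalent y z) :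
    Equivalent x z := by
  obtain ⟨σ, hσ, rfl⟩ := h
  obtain ⟨τ, hτ, rfl⟩ := k
  exact ⟨τ * σ, mul_mem hτ hσ, rfl⟩

/-- A surjection preserving `{·,·}` and `q` acts through the group. -/
theorem equivalent_of_surjective {f : Freudenthal J → Freudenthal J}
    (hf : Function.Surjective f) (hs : ∀ x y, symp (f x) (f y) = symp x y)
    (hq : ∀ x, q (f x) = q x) (x : Freudenthal J) : Equivalent x (f x) := by
  -- Additivity and injectivity are forced by invariance of the nondegenerate form `{·,·}`;
  -- additivity also uses surjectivity.
  have hadd : ∀ x y, f (x + y) = f x + f y := fun x y => symp_ext fun w => by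
    obtain ⟨w, rfl⟩ := hf w
    rw [symp_add_left, hs, hs, hs, symp_add_left]
  have hinj : Function.Injective f := fun x y h => symp_ext fun w => by
    rw [← hs x, h, hs]
  let σ : Freudenthal J ≃ₗ[ℤ] Freudenthal J :=
    LinearEquiv.ofBijective (AddMonoidHom.mk' f hadd).toIntLinearMap ⟨hinj, hf⟩
  exact ⟨σ, ⟨hs, hq⟩, rfl⟩

/-- Both sides of the equation characterizing `T` are invariant, so uniqueness gives equivariance.
-/
theorem tFormula_map {σ : Freudenthal J ≃ₗ[ℤ] Freudenthal J} (hσ : σ ∈ group J) (x : Freudenthal J) :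
    tFormula (σ x) = σ (tFormula x) :=
  symp_ext fun w => by
    obtain ⟨w, rfl⟩ := σ.surjective w
    rw [hσ.1]
    have h : qLin (σ x) (σ x) (σ x) (σ w) = qLin x x x w := by
      simp only [qLin, ← map_add, hσ.2]
    have := symp_tFormula (σ x) (σ w)
    rw [h, ← symp_tFormula x w] at this
    exact_mod_cast this

/-! ### Generators of the group -/

/-- The exchange of the two halves of `M(J)`. -/
def exchange (x : Freudenthal J) : Freudenthal J := ⟨-x.β, x.α, -x.B, x.A⟩

theorem equivalent_exchange (x : Freudenthal J) : Equivalent x (exchange x) := by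
  refine equivalent_of_surjective (f := exchange) (fun y => ⟨⟨y.β, -y.α, y.B, -y.A⟩, ?_⟩)
    (fun x y => ?_) (fun x => ?_) x
  · ext1 <;> simp [exchange]
  · simp only [symp, exchange, bil_neg, bil_neg_right]
    ring
  · simp only [q, exchange, bil_neg, sharp_neg, N_neg]
    rw [bil_comm x.B, bil_comm (sharp x.B)]
    ring

theorem equivalent_neg (x : Freudenthal J) : Equivalent x (-x) := by
  refine ((equivalent_exchange x).trans (equivalent_exchange _)).trans ?_
  have : exchange (exchange x) = -x := by ext1 <;> rfl
  rw [this]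
  exact Equivalent.refl _

/-- The map of `M(J)` induced by a norm pair. -/
def lift (g g' : J → J) (x : Freudenthal J) : Freudenthal J := ⟨x.α, x.β, g x.A, g' x.B⟩

theorem lift_surjective {g g' : J → J} (P : IsNormPair g g') :
    Function.Surjective (lift g g') := fun y => by
  obtain ⟨a, ha⟩ := P.surj_left y.A
  obtain ⟨b, hb⟩ := P.surj_right y.B
  exact ⟨⟨y.α, y.β, a, b⟩, by ext1 <;> simp [lift, ha, hb]⟩

theorem q_lift {g g' : J → J} (P : IsNormPair g g') (x : Freudenthal J) :
    q (lift g g' x) = q x := by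
  simp only [q, lift, P.sharp_map, P.symm.sharp_map, P.symm.bil_map, P.bil_map, P.N_left,
    P.N_right]

theorem equivalent_lift {g g' : J → J} (P : IsNormPair g g') (x : Freudenthal J) :
    Equivalent x (lift g g' x) :=
  equivalent_of_surjective (lift_surjective P)
    (fun x y => by simp only [symp, lift, P.bil_map, P.symm.bil_map]) (q_lift P) x

/-- The unipotent map of `M(J)` attached to `C ∈ J`. -/
def translate (C : J) (x : Freudenthal J) : Freudenthal J where
  α := x.α
  β := x.β + bil x.A C + bil x.B (sharp C) + x.α * N C
  A := x.A + cross x.B C + x.α • sharp C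
  B := x.B + x.α • C

/-- Makes `translate (-C)` the inverse of `translate C`, and the parameters that preserve `q` a
subgroup. -/
theorem translate_add (C D : J) (x : Freudenthal J) :
    translate (C + D) x = translate C (translate D x) := by
  have h : bil (cross x.B D) C = bil x.B (cross C D) := by rw [bil_cross, cross_comm]
  ext1
  · rfl
  · simp only [translate, bil_add, bil_add_right, sharp_add, N_add, bil_smul, h]
    rw [bil_comm C (sharp D)]
    rw [bil_comm D (sharp C)]
    ring
  · simp only [translate, cross_add_left, cross_add_right, sharp_add, smul_add, cross_smul]
    rw [cross_comm D C]
    abel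
  · simp only [translate, smul_add]
    abel

theorem translate_zero (x : Freudenthal J) : translate 0 x = x := by
  ext1 <;> simp [translate, bil_zero_right, sharp_zero, N_zero, cross_zero_right]

theorem translate_surjective (C : J) : Function.Surjective (translate C) := fun y =>
  ⟨translate (-C) y, by rw [← translate_add, add_neg_cancel, translate_zero]⟩

/-- The cubic laws alone suffice here. Invariance of `q` is not derived from them: it is the
defining condition of `translations`. -/
theorem symp_translate (C : J) (x y : Freudenthal J) :
    symp (translate C x) (translate C y) = symp x y := by
  have h1 : bil (cross x.B C) y.B = bil x.B (cross y.B C) := by rw [bil_cross, cross_comm C]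
  have h2 : bil (cross x.B C) C = 2 * bil x.B (sharp C) := by
    rw [bil_cross, cross_self, bil_smul_right]
  have h3 : bil C (cross y.B C) = 2 * bil y.B (sharp C) := by
    rw [bil_comm, bil_cross, cross_self, bil_smul_right]
  have h4 := bil_sharp_self C
  simp only [symp, translate, bil_add, bil_add_right, bil_smul, bil_smul_right, h1, h2, h3]
  rw [bil_comm C (sharp C), bil_comm (sharp C) y.B, bil_comm C y.A]
  ring

variable (J) in
/-- The elements of `J` whose unipotent map preserves `q`. -/
def translations : AddSubgroup J where
  carrier := {C | ∀ x, q (translate C x) = q x}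
  add_mem' := fun {C D} hC hD x => by rw [translate_add, hC, hD]
  zero_mem' := fun x => by rw [translate_zero]
  neg_mem' := fun {C} hC x => by
    rw [← hC (translate (-C) x), ← translate_add, add_neg_cancel, translate_zero]

theorem map_mem_translations {g g' : J → J} (P : IsNormPair g g') {C : J}
    (hC : C ∈ translations J) : g C ∈ translations J := fun y => by
  obtain ⟨x, rfl⟩ := lift_surjective P.symm y
  -- The parameter `C` is added to the `B` coordinate, so `g` has to act on that coordinate and `g'`
  -- on `A`.
  have : translate (g C) (lift g' g x) = lift g' g (translate C x) := by
    ext1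
    · rfl
    · simp only [translate, lift, P.symm.bil_map, P.sharp_map, P.bil_map, P.N_left]
    · simp only [translate, lift, P.cross_map, P.sharp_map, P.symm.map_add, P.symm.map_smul]
    · simp only [translate, lift, P.map_add, P.map_smul]
  rw [this, q_lift P.symm, hC, q_lift P.symm]

theorem equivalent_translate {C : J} (hC : C ∈ translations J) (x : Freudenthal J) :
    Equivalent x (translate C x) :=
  equivalent_of_surjective (translate_surjective C) (symp_translate C) hC x

/-- The opposite unipotent map, which fixes `β` and moves `α`: `translate D` conjugated by
`exchange`. The final negation appears because `exchange` squares to `-1`. -/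
theorem equivalent_cotranslate {D : J} (hD : D ∈ translations J) (x : Freudenthal J) :
    Equivalent x ⟨x.α - bil x.B D + bil x.A (sharp D) - x.β * N D, x.β, x.A - x.β • D,
      x.B - cross x.A D + x.β • sharp D⟩ := by
  refine (((equivalent_exchange x).trans (equivalent_translate hD _)).trans
    (equivalent_exchange _)).trans ((equivalent_neg _).trans ?_)
  convert Equivalent.refl _ using 1
  ext1
  · simp only [translate, exchange, neg_α, bil_neg]
    ring
  · simp [translate, exchange]
  · simp [translate, exchange, sub_eq_add_neg]
  · simp only [translate, exchange, neg_B, neg_smul]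
    abel

/-! ### Divisors of `T(x, x, x)` -/

/-- The integer `d` divides `T(x, x, x)`. -/
def DvdT (d : ℤ) (x : Freudenthal J) : Prop := ∃ y, tFormula x = d • y

theorem Equivalent.dvdT {x y : Freudenthal J} (h : Equivalent x y) {d : ℤ} (hd : DvdT d x) :
    DvdT d y := by
  obtain ⟨σ, hσ, rfl⟩ := h
  obtain ⟨z, hz⟩ := hd
  exact ⟨σ z, by rw [tFormula_map hσ, hz, map_smul]⟩

theorem Equivalent.symm {x y : Freudenthal J} (h : Equivalent x y) : Equivalent y x := by
  obtain ⟨σ, hσ, rfl⟩ := h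
  exact ⟨σ⁻¹, inv_mem hσ, σ.symm_apply_apply x⟩

theorem eq_one_of_dvdT {x : Freudenthal J} (h : x.T.gcd = 1) {d : ℕ} (hd : DvdT d x) :
    d = 1 := by
  rw [T_eq_tFormula] at h
  obtain ⟨y, hy⟩ := hd
  have hb : BddAbove {d : ℕ | ∃ y : Freudenthal J, tFormula x = d • y} := by
    -- In `ℕ` the supremum of an unbounded set is 0, so the value 1 forces boundedness, and in
    -- particular `T ≠ 0`.
    by_contra hb
    rw [gcd, Nat.sSup_of_not_bddAbove hb] at h
    exact zero_ne_one h
  have hle : d ≤ 1 := h ▸ le_csSup hb ⟨y, by simpa using hy⟩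
  interval_cases d
  · obtain ⟨n, hn⟩ := hb
    have h0 : tFormula x = 0 := by simpa using hy
    have : n + 1 ≤ n := hn ⟨0, by simp [h0]⟩
    omega
  · rfl

theorem gcd_T_eq_one {x : Freudenthal J} (h : ∀ d : ℕ, DvdT d x → d = 1) : x.T.gcd = 1 := by
  rw [T_eq_tFormula, gcd]
  have : {d : ℕ | ∃ y : Freudenthal J, tFormula x = d • y} = {1} := by
    ext d
    refine ⟨fun ⟨y, hy⟩ => h d ⟨y, by simpa using hy⟩, ?_⟩
    rintro rfl
    exact ⟨tFormula x, by simp⟩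
  rw [this, csSup_singleton]

theorem exists_dvdT_of_three_le {x : Freudenthal J} (h : 3 ≤ x.T.gcd ∨ x.T = 0) :
    ∃ d : ℕ, 3 ≤ d ∧ DvdT d x := by
  rw [T_eq_tFormula] at h
  rcases h with h | h
  · refine ⟨_, h, ?_⟩
    have hb : BddAbove {d : ℕ | ∃ y : Freudenthal J, tFormula x = d • y} := by
      by_contra hb
      rw [gcd, Nat.sSup_of_not_bddAbove hb] at h
      omega
    obtain ⟨y, hy⟩ := Nat.sSup_mem (s := {d : ℕ | ∃ y : Freudenthal J, tFormula x = d • y})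
      ⟨1, tFormula x, by simp⟩ hb
    exact ⟨y, by rw [gcd, natCast_zsmul]; exact hy⟩
  · exact ⟨3, le_rfl, 0, by simp [h]⟩

/-- Put `s = (A,B) - αβ`. Since `q' ≡ s²` mod 4, `s` is odd. Modulo 2 the `α` and `A` coordinates of
`T` are `sα` and `sA`; if both vanish, `α` and `A` are even and so is `s`. -/
theorem not_two_dvdT {x : Freudenthal J} (h : Odd x.q') : ¬ DvdT 2 x := by
  rintro ⟨y, hy⟩
  obtain ⟨s, hs⟩ : ∃ s, bil x.A x.B - x.α * x.β = s := ⟨_, rfl⟩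
  have hα := congrArg Freudenthal.α hy
  have hA := congrArg Freudenthal.A hy
  have hB := congrArg Freudenthal.B hy
  simp only [tFormula, smul_α, smul_A, smul_B, hs] at hα hA hB
  have hodd : Odd s := by
    rw [← Int.not_even_iff_odd]
    rintro ⟨t, rfl⟩
    obtain ⟨m, hm⟩ := h
    simp only [q', hs] at hm
    have := congrArg (· % 2) hm
    ring_nf at this
    omega
  obtain ⟨t, rfl⟩ := hodd
  have hA' : x.A = (2 : ℤ) • (cross x.B (sharp x.A) - x.β • sharp x.B - t • x.A - y.A) := by
    have e : x.A = (2 : ℤ) • cross x.B (sharp x.A) - (2 * x.β) • sharp x.B - (2 * t) • x.A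
        - (2 : ℤ) • y.A := by
      rw [← hA, add_smul, one_smul]; abel
    nth_rewrite 1 [e]
    simp only [smul_sub, mul_smul]
  obtain ⟨u, hu⟩ : ∃ u, x.α = 2 * u := by
    refine ⟨y.α - x.α * t + N x.B, ?_⟩
    have : -x.α ^ 2 * x.β + x.α * bil x.A x.B = x.α * (2 * t + 1) := by rw [← hs]; ring
    linarith
  rw [hA', bil_smul, hu] at hs
  have := congrArg (· % 2) hs
  simp only [mul_assoc, ← mul_sub] at this
  omega

end Freudenthal

end IntegralFreudenthal

namespace IntegralFreudenthal
open CompositionRing CubicLattice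

/-! ### Polarized composition laws. -/

section compositionLaws

variable {C : Type} [NonUnitalNonAssocRing C] [CompositionRing C]

theorem bar_neg (x : C) : bar (-x) = -bar x := by simpa using bar_zsmul (-1) x

theorem tr_neg (x : C) : tr (-x) = -tr x := by simpa using tr_zsmul (-1) x

theorem nm_zero' : nm (0 : C) = 0 := by simpa using nm_zsmul 0 (0 : C)

theorem nm_neg (x : C) : nm (-x) = nm x := by simpa using nm_zsmul (-1) x

theorem nm_bar (x : C) : nm (bar x) = nm x := by
  have h := tr_mul_bar (bar x)
  rw [bar_bar, tr_mul_comm, tr_mul_bar] at h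
  linarith

theorem nm_sub (x y : C) : nm (x - y) = nm x - tr (x * bar y) + nm y := by
  rw [sub_eq_add_neg, nm_add, bar_neg, mul_neg, tr_neg, nm_neg]
  ring

/-- Multiplicativity of the norm, linearized in the second factor. This and its mirror image replace
associativity, which fails for octonions. -/
theorem tr_mul_mul_bar_left (x y z : C) :
    tr (x * y * bar (x * z)) = nm x * tr (y * bar z) := by
  have h := nm_mul x (y + z)
  rw [mul_add, nm_add, nm_add, nm_mul, nm_mul] at h
  linarith

theorem tr_mul_mul_bar_right (x y z : C) :
    tr (y * x * bar (z * x)) = nm x * tr (y * bar z) := by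
  have h := nm_mul (y + z) x
  rw [add_mul, nm_add, nm_add, nm_mul, nm_mul] at h
  linarith

theorem tr_cycle (x y z : C) : tr (x * y * z) = tr (y * z * x) := by
  rw [tr_mul_assoc, tr_mul_comm]

end compositionLaws

/-! ### Norm-preserving row and column operations on Hermitian matrices. -/

namespace Herm

variable {C : Type} [NonUnitalNonAssocRing C]

@[simp] theorem sub_a (A B : Herm C) : (A - B).a = A.a - B.a := rfl
@[simp] theorem sub_b (A B : Herm C) : (A - B).b = A.b - B.b := rfl
@[simp] theorem sub_c (A B : Herm C) : (A - B).c = A.c - B.c := rfl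
@[simp] theorem sub_x (A B : Herm C) : (A - B).x = A.x - B.x := rfl
@[simp] theorem sub_y (A B : Herm C) : (A - B).y = A.y - B.y := rfl
@[simp] theorem sub_z (A B : Herm C) : (A - B).z = A.z - B.z := rfl

@[simp] theorem neg_c (A : Herm C) : (-A).c = -A.c := rfl
@[simp] theorem neg_x (A : Herm C) : (-A).x = -A.x := rfl

variable [CompositionRing C]

/-- The cyclic permutation of the coordinates. -/
def cyc (A : Herm C) : Herm C := ⟨A.b, A.c, A.a, A.y, A.z, A.x⟩

theorem isNormPair_cyc : IsNormPair (cyc : Herm C → Herm C) cyc where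
  bil_map A B := by simp only [bil, cyc]; ring
  N_left A := by simp only [N, cyc]; rw [tr_cycle A.x]; ring
  N_right A := by simp only [N, cyc]; rw [tr_cycle A.x]; ring
  surj_left A := ⟨cyc (cyc A), rfl⟩
  surj_right A := ⟨cyc (cyc A), rfl⟩

/-- The transposition of the first two coordinates. -/
def swap (A : Herm C) : Herm C := ⟨A.b, A.a, A.c, bar A.y, bar A.x, bar A.z⟩

theorem swap_swap (A : Herm C) : swap (swap A) = A := by
  ext1 <;> simp [swap, bar_bar]

theorem isNormPair_swap : IsNormPair (swap : Herm C → Herm C) swap := by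
  have hN : ∀ A : Herm C, N (swap A) = N A := fun A => by
    simp only [N, swap, nm_bar]
    rw [tr_bar_bar_bar, tr_mul_comm]
    ring
  refine ⟨fun A B => ?_, hN, hN, fun A => ⟨_, swap_swap A⟩, fun A => ⟨_, swap_swap A⟩⟩
  simp only [bil, swap, bar_bar]
  rw [tr_mul_comm (bar A.x), tr_mul_comm (bar A.y), tr_mul_comm (bar A.z),
    tr_mul_bar_comm B.x, tr_mul_bar_comm B.y, tr_mul_bar_comm B.z]
  ring

/-- Adding `w` times the second row to the first, and likewise for the columns. -/
def transvect (w : C) (A : Herm C) : Herm C :=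
  ⟨A.a + tr (A.z * bar w) + A.b * nm w, A.b, A.c, A.x, A.y + bar A.x * bar w, A.z + A.b • w⟩

/-- The map dual to `transvect w` under the trace form. -/
def cotransvect (w : C) (A : Herm C) : Herm C := swap (transvect (-bar w) (swap A))

theorem transvect_neg_right (w : C) (A : Herm C) : transvect w (transvect (-w) A) = A := by
  ext1
  · simp only [transvect, add_mul, tr_add, bar_neg, mul_neg, tr_neg, nm_neg, smul_neg,
      smul_mul_assoc, neg_mul, tr_zsmul, tr_mul_bar]
    ring
  · rfl
  · rfl
  · rfl
  · simp [transvect, bar_neg]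
  · simp [transvect]

theorem N_transvect (w : C) (A : Herm C) : N (transvect w A) = N A := by
  have h1 : tr (A.y * bar (bar A.x * bar w)) = tr (A.x * A.y * w) := by
    rw [CompositionRing.bar_mul, bar_bar, bar_bar, ← tr_mul_assoc, ← tr_cycle]
  -- `x(x̄w̄)` is not reassociated: its trace against `z` is evaluated by the linearized norm law,
  -- and likewise in `h3`.
  have h2 : tr (A.x * (bar A.x * bar w) * A.z) = nm A.x * tr (A.z * bar w) := by
    have h := tr_mul_mul_bar_left (bar A.x) (bar w) (bar A.z)
    rw [CompositionRing.bar_mul, bar_bar, bar_bar, ← tr_mul_assoc, nm_bar] at h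
    rw [tr_mul_assoc, tr_mul_comm, h, tr_mul_comm]
  have h3 : tr (A.x * (bar A.x * bar w) * w) = 2 * (nm A.x * nm w) := by
    have h := tr_mul_mul_bar_left (bar A.x) (bar w) (bar w)
    rw [CompositionRing.bar_mul, bar_bar, bar_bar, ← tr_mul_assoc, nm_bar, tr_mul_comm (bar w),
      tr_mul_bar] at h
    rw [tr_mul_assoc, tr_mul_comm, h]
    ring
  simp only [N, transvect, nm_add, nm_mul, nm_bar, nm_zsmul, bar_zsmul, mul_smul_comm, tr_zsmul,
    mul_add, add_mul, tr_add, h1, h2, h3]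
  ring

theorem isNormPair_transvect (w : C) : IsNormPair (transvect w) (cotransvect w) where
  bil_map A B := by
    have h2 : tr (bar A.x * bar w * bar B.y) = tr (A.x * B.y * w) := by
      rw [tr_bar_bar_bar, tr_mul_comm, tr_cycle, tr_cycle, tr_mul_comm, ← tr_mul_assoc]
    have h3 : tr (bar B.z * w) = tr (B.z * bar w) := by rw [tr_mul_comm, tr_mul_bar_comm]
    simp only [bil, cotransvect, transvect, swap, bar_bar, bar_neg, bar_add, bar_zsmul, nm_neg,
      nm_bar, mul_neg, tr_neg, mul_add, add_mul, tr_add, smul_neg, smul_mul_assoc,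
      mul_smul_comm, tr_zsmul, h2, h3, CompositionRing.bar_mul, tr_mul_bar]
    rw [tr_mul_bar_comm w, ← tr_mul_assoc A.x]
    ring
  N_left := N_transvect w
  N_right A := by
    rw [cotransvect, isNormPair_swap.N_left, N_transvect, isNormPair_swap.N_left]
  surj_left A := ⟨_, transvect_neg_right w A⟩
  surj_right A := ⟨swap (transvect (bar w) (swap A)), by
    have h := transvect_neg_right (-bar w) (swap A)
    rw [neg_neg] at h
    rw [cotransvect, swap_swap, h, swap_swap]⟩

/-! ### The unipotent maps of `M(J)` -/

theorem sharp_idempotent (k : ℤ) : sharp (⟨k, 0, 0, 0, 0, 0⟩ : Herm C) = 0 := by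
  ext1 <;> simp [sharp, nm_zero']

theorem cross_idempotent (B : Herm C) (k : ℤ) :
    cross B ⟨k, 0, 0, 0, 0, 0⟩ = ⟨0, k * B.c, k * B.b, -(k • B.x), 0, 0⟩ := by
  unfold cross
  rw [sharp_idempotent]
  ext1 <;> simp [sharp, add_smul] <;> ring

open Freudenthal

theorem idempotent_mem_translations (k : ℤ) :
    (⟨k, 0, 0, 0, 0, 0⟩ : Herm C) ∈ translations (Herm C) := fun u => by
  obtain ⟨α, β, ⟨a, b, c, x, y, z⟩, ⟨a', b', c', x', y', z'⟩⟩ := u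
  have e : Freudenthal.translate ⟨k, 0, 0, 0, 0, 0⟩
      ⟨α, β, ⟨a, b, c, x, y, z⟩, ⟨a', b', c', x', y', z'⟩⟩ =
      (⟨α, β + a * k, ⟨a, b + k * c', c + k * b', x - k • x', y, z⟩,
        ⟨a' + α * k, b', c', x', y', z'⟩⟩ : Freudenthal (Herm C)) := by
    rw [Freudenthal.translate, cross_idempotent, sharp_idempotent, N_eq_zero_of_sharp_eq_zero
      (sharp_idempotent k)]
    ext1
    · rfl
    · simp [bil, tr_zero']
    · ext1 <;> simp [sub_eq_add_neg]
    · ext1 <;> simp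
  -- These rules bring all traces in the expansion of `q` to a common form. `r4` and `r7` come from
  -- linearized composition; the others are cyclicity, associativity of the trace and conjugation.
  have r1 : tr (bar z * bar y * bar x') = tr (x' * y * z) := by
    rw [tr_bar_bar_bar, tr_mul_assoc]
  have r2 : tr (x * (y' * z')) = tr (x * y' * z') := (tr_mul_assoc _ _ _).symm
  have r3 : tr (x' * (y' * z')) = tr (x' * y' * z') := (tr_mul_assoc _ _ _).symm
  have r4 : tr (bar x' * bar z * (z' * x')) = nm x' * tr (z * bar z') := by
    have h := tr_mul_mul_bar_left (bar x') (bar z) (bar z')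
    rw [CompositionRing.bar_mul, bar_bar, bar_bar, nm_bar, tr_mul_comm (bar z),
      tr_mul_bar_comm z'] at h
    exact h
  have r5 : tr (bar x' * bar z * bar y') = tr (x' * y' * z) := by
    rw [tr_bar_bar_bar, ← tr_mul_assoc, tr_cycle, tr_cycle]
  have r6 : tr (y * (z' * x')) = tr (x' * y * z') := by
    rw [← tr_mul_assoc, tr_cycle, tr_cycle]
  have r7 : tr (bar y * bar x' * (x' * y')) = nm x' * tr (y * bar y') := by
    have h := tr_mul_mul_bar_right (bar x') (bar y) (bar y')
    rw [CompositionRing.bar_mul, bar_bar, bar_bar, nm_bar, tr_mul_comm (bar y),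
      tr_mul_bar_comm y'] at h
    exact h
  have r8 : tr (bar y * bar x' * bar z') = tr (x' * y * z') := by
    rw [tr_bar_bar_bar, tr_mul_comm]
  have r9 : tr (z * (x' * y')) = tr (x' * y' * z) := tr_mul_comm _ _
  rw [e]
  simp only [q, bil, sharp, N, bar_sub, bar_zsmul, sub_mul, mul_sub, tr_sub,
    CompositionRing.bar_mul, bar_bar, smul_mul_assoc, mul_smul_comm, tr_zsmul, nm_sub, nm_zsmul,
    tr_mul_bar, r1, r2, r3, r4, r5, r6, r7, r8, r9]
  ring

/-- `translations` is a subgroup stable under norm pairs, and the images of the multiples of one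
idempotent generate the whole lattice. -/
theorem mem_translations (D : Herm C) : D ∈ translations (Herm C) := by
  have hcyc : ∀ {D : Herm C}, D ∈ translations (Herm C) → cyc D ∈ translations (Herm C) :=
    fun h => map_mem_translations isNormPair_cyc h
  have h1 := fun k => idempotent_mem_translations (C := C) k
  have hz : ∀ w : C, (⟨0, 0, 0, 0, 0, w⟩ : Herm C) ∈ translations (Herm C) := fun w => by
    -- `transvect w` sends the second diagonal idempotent to the matrix with diagonal `(nm w, 1, 0)`
    -- and `z = w`; removing the diagonal leaves the pure entry `w`.
    have h := sub_mem (sub_mem (map_mem_translations (isNormPair_transvect w)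
      (hcyc (hcyc (h1 1)))) (hcyc (hcyc (h1 1)))) (h1 (nm w))
    convert h using 1
    ext1 <;> simp [transvect, cyc, tr_zero']
  have h := add_mem (add_mem (add_mem (h1 D.a) (hcyc (hcyc (h1 D.b)))) (hcyc (h1 D.c)))
    (add_mem (add_mem (hcyc (hcyc (hz D.x))) (hcyc (hz D.y))) (hz D.z))
  convert h using 1
  ext1 <;> simp [cyc]

/-! ### Diagonalization -/

theorem cotransvect_eq (w : C) (A : Herm C) : cotransvect w A =
    ⟨A.a, A.b - tr (A.z * bar w) + A.a * nm w, A.c, A.x - bar w * bar A.y, A.y,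
      A.z - A.a • w⟩ := by
  ext1
  · rfl
  · simp only [cotransvect, transvect, swap, bar_neg, bar_bar, mul_neg, tr_neg, nm_neg, nm_bar]
    rw [tr_mul_comm, tr_mul_bar_comm]
    ring
  · rfl
  · simp only [cotransvect, transvect, swap, bar_neg, bar_bar, bar_add, mul_neg,
      CompositionRing.bar_mul, sub_eq_add_neg]
  · simp [cotransvect, transvect, swap, bar_bar]
  · simp [cotransvect, transvect, swap, bar_add, bar_neg, bar_zsmul, bar_bar, sub_eq_add_neg]

/-- Two Hermitian matrices correspond to each other under some norm pair. -/
def Congruent (A B : Herm C) : Prop := ∃ g g', IsNormPair g g' ∧ g A = B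

theorem Congruent.refl (A : Herm C) : Congruent A A := ⟨id, id, IsNormPair.id, rfl⟩

theorem Congruent.map {A B : Herm C} (h : Congruent A B) {g g' : Herm C → Herm C}
    (P : IsNormPair g g') : Congruent A (g B) := by
  obtain ⟨f, f', Q, rfl⟩ := h
  exact ⟨g ∘ f, g' ∘ f', P.comp Q, rfl⟩

end Herm

theorem exists_minimal_abs {X : Type} (f : X → ℤ) {S : X → Prop} {x : X} (hx : S x)
    (h0 : f x ≠ 0) : ∃ y, S y ∧ f y ≠ 0 ∧ ∀ z, S z → f z ≠ 0 → |f y| ≤ |f z| := by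
  classical
  have h : ∃ n : ℕ, ∃ y, S y ∧ f y ≠ 0 ∧ (f y).natAbs = n := ⟨_, x, hx, h0, rfl⟩
  obtain ⟨y, hy, hy0, hn⟩ := Nat.find_spec h
  refine ⟨y, hy, hy0, fun z hz hz0 => ?_⟩
  have := Nat.find_min' h ⟨z, hz, hz0, rfl⟩
  rw [Int.abs_eq_natAbs, Int.abs_eq_natAbs]
  omega

/-- The Euclidean step of both descents: `a` is minimal in a class where `t % a`, up to sign, also
occurs. -/
theorem dvd_of_forall_abs_le {a t : ℤ} (ha : a ≠ 0) (h : t % a ≠ 0 → |a| ≤ |t % a|) : a ∣ t := by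
  by_contra hd
  have h0 : t % a ≠ 0 := fun h0 => hd (Int.dvd_of_emod_eq_zero h0)
  have h1 := Int.emod_nonneg t ha
  have h2 := Int.emod_lt_abs t ha
  have h3 := h h0
  rw [abs_of_nonneg h1] at h3
  omega

/-- Divisibility in `C` is detected by pairing with isotropic unimodular vectors. -/
def IsotropicallyDetected (C : Type) [NonUnitalNonAssocRing C] [CompositionRing C] : Prop :=
  ∀ (d : ℤ) (z : C), (∀ w u : C, nm w = 0 → tr (u * bar w) = 1 → d ∣ tr (z * bar w)) →
    ∃ v, z = d • v

namespace Herm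

variable {C : Type} [NonUnitalNonAssocRing C] [CompositionRing C]

theorem exists_a_ne_zero (hC : IsotropicallyDetected C) {S : Herm C → Prop}
    (hs : ∀ A, S A → S (swap A)) (ht : ∀ w A, S A → S (transvect w A)) {A : Herm C} (hA : S A)
    (h : A.a ≠ 0 ∨ A.b ≠ 0 ∨ A.z ≠ 0) : ∃ B, S B ∧ B.a ≠ 0 := by
  by_cases ha : A.a = 0
  · by_cases hb : A.b = 0
    · have hz : A.z ≠ 0 := by tauto
      by_contra! hcon
      refine hz ?_
      -- With `d = 0`, divisibility means vanishing, so a nonzero `z` pairs nontrivially with some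
      -- `w`.
      obtain ⟨v, hv⟩ := hC 0 A.z fun w _ _ _ => by
        have := hcon _ (ht w A hA)
        simp only [transvect, ha, hb] at this
        simpa using this
      simpa using hv
    · exact ⟨_, hs A hA, hb⟩
  · exact ⟨A, hA, ha⟩

theorem exists_z_eq_smul (hC : IsotropicallyDetected C) {S : Herm C → Prop}
    (ht : ∀ w A, S A → S (transvect w A)) (hc : ∀ w A, S A → S (cotransvect w A)) {A : Herm C}
    (hA : S A) (ha : A.a ≠ 0) (hmin : ∀ B, S B → B.a ≠ 0 → |A.a| ≤ |B.a|) :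
    ∃ v, A.z = A.a • v := by
  refine hC _ _ fun w u hw hu => dvd_of_forall_abs_le ha fun h => ?_
  -- With `t = tr (z w̄)` and `c = 1 + t / a`, subtracting `a c u` from `z` and then transvecting by
  -- the isotropic `w` turns `a` into `a + t - a c = t % a`; the summand 1 cancels the original `a`.
  have hB := ht w _ (hc ((1 + tr (A.z * bar w) / A.a) • u) A hA)
  have e : (transvect w (cotransvect ((1 + tr (A.z * bar w) / A.a) • u) A)).a
      = tr (A.z * bar w) % A.a := by
    rw [cotransvect_eq]
    simp only [transvect, hw, sub_mul, tr_sub, smul_mul_assoc, tr_zsmul, hu]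
    have := Int.emod_add_mul_ediv (tr (A.z * bar w)) A.a
    linarith
  rw [← e] at h ⊢
  exact hmin _ hB h

/-- Operations on the first two rows keep `x = y = 0`. Under these a least nonzero `a` divides `z`,
and one `cotransvect` clears it. -/
theorem exists_congruent_diag_of_block (hC : IsotropicallyDetected C) (A : Herm C)
    (hx : A.x = 0) (hy : A.y = 0) : ∃ a, Congruent A (diag a) := by
  let S : Herm C → Prop := fun B => Congruent A B ∧ B.x = 0 ∧ B.y = 0
  have hs : ∀ B, S B → S (swap B) := fun B ⟨h, h1, h2⟩ =>
    ⟨h.map isNormPair_swap, by simp [swap, h2], by simp [swap, h1]⟩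
  have ht : ∀ w B, S B → S (transvect w B) := fun w B ⟨h, h1, h2⟩ =>
    ⟨h.map (isNormPair_transvect w), h1, by simp [transvect, h1, h2]⟩
  have hc : ∀ w B, S B → S (cotransvect w B) := fun w B h => hs _ (ht _ _ (hs _ h))
  by_cases h : A.a ≠ 0 ∨ A.b ≠ 0 ∨ A.z ≠ 0
  · obtain ⟨B, hB, hB0⟩ := exists_a_ne_zero hC hs ht (A := A) ⟨Congruent.refl A, hx, hy⟩ h
    obtain ⟨D, hD, hD0, hmin⟩ := exists_minimal_abs Herm.a hB hB0
    obtain ⟨v, hv⟩ := exists_z_eq_smul hC ht hc hD hD0 hmin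
    obtain ⟨h, h1, h2⟩ := hc v D hD
    refine ⟨![(cotransvect v D).a, (cotransvect v D).b, (cotransvect v D).c], ?_⟩
    convert h using 1
    ext1
    · rfl
    · rfl
    · rfl
    · exact h1.symm
    · exact h2.symm
    · simp [cotransvect_eq, hv, diag]
  · push Not at h
    refine ⟨![A.a, A.b, A.c], ?_⟩
    convert Congruent.refl A using 1
    ext1
    · rfl
    · rfl
    · rfl
    · exact hx.symm
    · exact hy.symm
    · exact h.2.2.symm

theorem Congruent.trans {A B D : Herm C} (h : Congruent A B) (k : Congruent B D) :
    Congruent A D := by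
  obtain ⟨g, g', P, rfl⟩ := k
  exact h.map P

/-- Every Hermitian matrix over a suitable composition ring can be diagonalized. -/
theorem exists_congruent_diag (hC : IsotropicallyDetected C) (A : Herm C) :
    ∃ a, Congruent A (diag a) := by
  have hs : ∀ B, Congruent A B → Congruent A (swap B) := fun B h => h.map isNormPair_swap
  have hcy : ∀ B, Congruent A B → Congruent A (cyc B) := fun B h => h.map isNormPair_cyc
  have ht : ∀ w B, Congruent A B → Congruent A (transvect w B) := fun w B h =>
    h.map (isNormPair_transvect w)
  have hc : ∀ w B, Congruent A B → Congruent A (cotransvect w B) := fun w B h =>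
    h.map (isNormPair_transvect w).symm
  have hA := Congruent.refl A
  by_cases h : ∃ B, Congruent A B ∧ B.a ≠ 0
  · obtain ⟨B, hB, hB0⟩ := h
    obtain ⟨D, hD, hD0, hmin⟩ := exists_minimal_abs Herm.a hB hB0
    obtain ⟨v, hv⟩ := exists_z_eq_smul hC ht hc hD hD0 hmin
    -- the second off-diagonal entry of the first row, moved next to the diagonal
    have hE := hcy _ (hs _ (hc v D hD))
    have hz : (cotransvect v D).z = 0 := by simp [cotransvect_eq, hv]
    have ha : (cyc (swap (cotransvect v D))).a = D.a := rfl
    have hy : (cyc (swap (cotransvect v D))).y = 0 := by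
      change bar (cotransvect v D).z = 0
      rw [hz, bar_zero']
    generalize cyc (swap (cotransvect v D)) = E at hE ha hy
    rw [← ha] at hD0 hmin
    obtain ⟨u, hu⟩ := exists_z_eq_smul hC ht hc hE hD0 hmin
    -- The second clearing leaves `y = 0` intact, and `cyc` moves the one surviving off-diagonal
    -- entry `x` to the position `z`.
    obtain ⟨a, h⟩ := exists_congruent_diag_of_block hC (cyc (cotransvect u E))
      (by simpa [cyc, cotransvect_eq] using hy) (by simp [cyc, cotransvect_eq, hu])
    exact ⟨a, (hcy _ (hc u E hE)).trans h⟩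
  · have key : ∀ B, Congruent A B → B.a = 0 ∧ B.b = 0 ∧ B.z = 0 := fun B hB => by
      by_contra hcon
      exact h (exists_a_ne_zero hC hs ht hB (by tauto))
    have k0 := key A hA
    have k1 := key _ (hcy _ hA)
    have k2 := key _ (hcy _ (hcy _ hA))
    exact exists_congruent_diag_of_block hC A k1.2.2 k2.2.2

/-! ### Reduction in `M(J)` -/

/-- Lifts isotropic detection from `C` to matrices: diagonal idempotents and single isotropic
off-diagonal entries have vanishing sharp, and together they test every coordinate. -/
theorem exists_eq_smul_of_dvd_bil (hC : IsotropicallyDetected C) (d : ℤ) (B : Herm C)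
    (h : ∀ D E : Herm C, sharp D = 0 → bil E D = 1 → d ∣ bil B D) : ∃ A, B = d • A := by
  have ha : d ∣ B.a := by
    simpa [bil, tr_zero'] using h ⟨1, 0, 0, 0, 0, 0⟩ ⟨1, 0, 0, 0, 0, 0⟩
      (by ext1 <;> simp [sharp, nm_zero']) (by simp [bil, tr_zero'])
  have hb : d ∣ B.b := by
    simpa [bil, tr_zero'] using h ⟨0, 1, 0, 0, 0, 0⟩ ⟨0, 1, 0, 0, 0, 0⟩
      (by ext1 <;> simp [sharp, nm_zero']) (by simp [bil, tr_zero'])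
  have hc : d ∣ B.c := by
    simpa [bil, tr_zero'] using h ⟨0, 0, 1, 0, 0, 0⟩ ⟨0, 0, 1, 0, 0, 0⟩
      (by ext1 <;> simp [sharp, nm_zero']) (by simp [bil, tr_zero'])
  obtain ⟨x, hx⟩ := hC d B.x fun w u hw hu => by
    simpa [bil, tr_zero'] using h ⟨0, 0, 0, w, 0, 0⟩ ⟨0, 0, 0, u, 0, 0⟩
      (by ext1 <;> simp [sharp, nm_zero', hw]) (by simpa [bil, tr_zero'] using hu)
  obtain ⟨y, hy⟩ := hC d B.y fun w u hw hu => by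
    simpa [bil, tr_zero'] using h ⟨0, 0, 0, 0, w, 0⟩ ⟨0, 0, 0, 0, u, 0⟩
      (by ext1 <;> simp [sharp, nm_zero', hw]) (by simpa [bil, tr_zero'] using hu)
  obtain ⟨z, hz⟩ := hC d B.z fun w u hw hu => by
    simpa [bil, tr_zero'] using h ⟨0, 0, 0, 0, 0, w⟩ ⟨0, 0, 0, 0, 0, u⟩
      (by ext1 <;> simp [sharp, nm_zero', hw]) (by simpa [bil, tr_zero'] using hu)
  obtain ⟨a, ha⟩ := ha
  obtain ⟨b, hb⟩ := hb
  obtain ⟨c, hc⟩ := hc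
  exact ⟨⟨a, b, c, x, y, z⟩, by ext1 <;> assumption⟩

end Herm

namespace Freudenthal

open Herm

variable {C : Type} [NonUnitalNonAssocRing C] [CompositionRing C]

theorem exists_equivalent_α_ne_zero (hC : IsotropicallyDetected C) {x : Freudenthal (Herm C)}
    (hx : x ≠ 0) : ∃ y, Equivalent x y ∧ y.α ≠ 0 := by
  have key : ∀ y, Equivalent x y → y.α = 0 → y.B ≠ 0 → ∃ y, Equivalent x y ∧ y.α ≠ 0 := by
    intro y hy hα hB
    by_contra! hcon
    obtain ⟨A, hA⟩ := exists_eq_smul_of_dvd_bil hC 0 y.B fun D E hD _ => by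
      have := hcon _ (hy.trans (equivalent_cotranslate (mem_translations D) y))
      simpa [hα, hD, N_eq_zero_of_sharp_eq_zero hD, bil_zero_right] using this
    exact hB (by simpa using hA)
  by_cases hα : x.α = 0
  · by_cases hβ : x.β = 0
    · by_cases hB : x.B = 0
      · refine key _ (equivalent_exchange x) (by simp [exchange, hβ]) fun hA => hx ?_
        ext1
        · exact hα
        · exact hβ
        · exact hA
        · exact hB
      · exact key x (Equivalent.refl x) hα hB
    · exact ⟨_, equivalent_exchange x, by simpa [exchange] using hβ⟩
  · exact ⟨x, Equivalent.refl x, hα⟩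

/-- The coordinate `α` is nonzero of least possible absolute value in the orbit. -/
def IsMinimal {J : Type} [AddCommGroup J] [CubicLattice J] (x : Freudenthal J) : Prop :=
  x.α ≠ 0 ∧ ∀ y, Equivalent x y → y.α ≠ 0 → |x.α| ≤ |y.α|

theorem IsMinimal.of_equivalent {J : Type} [AddCommGroup J] [CubicLattice J]
    {x y : Freudenthal J} (hx : IsMinimal x) (h : Equivalent x y) (hα : y.α = x.α) :
    IsMinimal y :=
  ⟨hα ▸ hx.1, fun z hz hz0 => hα ▸ hx.2 z (h.trans hz) hz0⟩

theorem IsMinimal.exists_B_eq_smul (hC : IsotropicallyDetected C) {x : Freudenthal (Herm C)}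
    (hx : IsMinimal x) : ∃ D, x.B = x.α • D := by
  refine exists_eq_smul_of_dvd_bil hC _ _ fun D E hD hE =>
    dvd_of_forall_abs_le hx.1 fun h => ?_
  -- With `t = (B,D)` and `c = 1 - t / α`, translating by `cE` keeps `α` and adds `αcE` to `B`; the
  -- opposite map along `D` then makes `α` into `α - t - αc = -(t % α)`.
  have hy := (equivalent_translate (mem_translations ((1 - bil x.B D / x.α) • E)) x).trans
    (equivalent_cotranslate (mem_translations D) _)
  have hmod := Int.emod_add_mul_ediv (bil x.B D) x.α
  rw [← abs_neg (_ % _)]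
  convert hx.2 _ hy ?_ using 2
  all_goals
    simp only [Freudenthal.translate, hD, N_eq_zero_of_sharp_eq_zero hD, bil_zero_right, bil_add,
      bil_smul, hE]
  · linarith
  · intro h0
    apply h
    linarith

theorem IsMinimal.dvd_A (hC : IsotropicallyDetected C) {x : Freudenthal (Herm C)}
    (hx : IsMinimal x) : x.α ∣ x.A.a ∧ ∃ w, x.A.x = x.α • w := by
  have key : ∀ {x : Freudenthal (Herm C)}, IsMinimal x →
      x.α ∣ x.A.b ∧ ∃ w, x.A.x = x.α • w := fun {x} hx => by
    -- Once `B` is cleared, which changes `A` only modulo `α`, the opposite map along an idempotent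
    -- keeps `α` and places entries of `A` in the new `B`. That `B` is again divisible by `α`.
    obtain ⟨D, hD⟩ := hx.exists_B_eq_smul hC
    have hy := hx.of_equivalent (equivalent_translate (mem_translations (-D)) x) rfl
    obtain ⟨E, hE⟩ : ∃ E, (Freudenthal.translate (-D) x).A = x.A + x.α • E :=
      ⟨cross D (-D) + sharp (-D), by
        rw [smul_add, ← cross_smul, ← hD, ← add_assoc]; rfl⟩
    have hB : (Freudenthal.translate (-D) x).B = 0 := by simp [Freudenthal.translate, hD]
    have hα : (Freudenthal.translate (-D) x).α = x.α := rfl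
    generalize Freudenthal.translate (-D) x = y at hy hE hB hα
    have hs := sharp_idempotent (C := C) 1
    obtain ⟨F, hF⟩ := (hy.of_equivalent (equivalent_cotranslate
      (mem_translations ⟨1, 0, 0, 0, 0, 0⟩) y) (by
        simp only [hs, N_eq_zero_of_sharp_eq_zero hs, hB, bil_zero_left, bil_zero_right]
        ring)).exists_B_eq_smul hC
    simp only [hs, N_eq_zero_of_sharp_eq_zero hs, hB, bil_zero_left, bil_zero_right, hE, hα,
      cross_idempotent, smul_zero, add_zero, zero_sub, sub_zero, mul_zero] at hF
    have hc := congrArg Herm.c hF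
    have hw := congrArg Herm.x hF
    refine ⟨⟨-F.c - E.b, ?_⟩, F.x - E.x, ?_⟩
    · simp at hc
      linarith
    · have hw' : x.A.x + x.α • E.x = x.α • F.x := by simpa only [neg_x, add_x, smul_x, one_smul,
        neg_neg] using hw
      rw [smul_sub, ← hw', add_sub_cancel_right]
  refine ⟨?_, (key hx).2⟩
  exact (key (hx.of_equivalent ((equivalent_lift isNormPair_cyc x).trans
    (equivalent_lift isNormPair_cyc _)) rfl)).1

theorem IsMinimal.exists_A_eq_smul (hC : IsotropicallyDetected C) {x : Freudenthal (Herm C)}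
    (hx : IsMinimal x) : ∃ D, x.A = x.α • D := by
  have h1 := hx.of_equivalent (equivalent_lift isNormPair_cyc x) rfl
  have h2 := h1.of_equivalent (equivalent_lift isNormPair_cyc _) rfl
  obtain ⟨⟨a, ha⟩, u, hu⟩ := hx.dvd_A hC
  obtain ⟨⟨b, hb⟩, v, hv⟩ := h1.dvd_A hC
  obtain ⟨⟨c, hc⟩, w, hw⟩ := h2.dvd_A hC
  exact ⟨⟨a, b, c, u, v, w⟩, by ext1 <;> assumption⟩

theorem dvdT_of_eq_smul {J : Type} [AddCommGroup J] [CubicLattice J] {x : Freudenthal J}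
    {D E : J} (hA : x.A = x.α • E) (hB : x.B = x.α • D) : DvdT x.α x := by
  obtain ⟨α, β, A, B⟩ := x
  change A = α • E at hA
  change B = α • D at hB
  subst hA hB
  refine ⟨⟨-α * β + α ^ 2 * bil E D - 2 * α ^ 2 * N D,
    β ^ 2 - β * α * bil E D + 2 * α ^ 2 * N E,
    (2 * α ^ 2) • cross D (sharp E) - (2 * β * α) • sharp D - (α ^ 2 * bil E D - α * β) • E,
    (2 * α ^ 2) • sharp E - (2 * α ^ 2) • cross E (sharp D) + (α ^ 2 * bil E D - α * β) • D⟩, ?_⟩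
  ext1
  · simp only [tFormula, smul_α, bil_smul, bil_smul_right, N_smul]
    ring
  · simp only [tFormula, smul_β, bil_smul, bil_smul_right, N_smul]
    ring
  · simp only [tFormula, smul_A, bil_smul, bil_smul_right, sharp_smul, cross_smul,
      cross_smul_right]
    module
  · simp only [tFormula, smul_B, bil_smul, bil_smul_right, sharp_smul, cross_smul,
      cross_smul_right]
    module

theorem exists_equivalent_diag (hC : IsotropicallyDetected C) {x : Freudenthal (Herm C)}
    (hT : ∀ d : ℕ, DvdT d x → d = 1) : ∃ β a, Equivalent x ⟨1, β, diag a, 0⟩ := by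
  have hx : x ≠ 0 := by
    rintro rfl
    have := hT 2 ⟨0, by ext1 <;> simp [tFormula, bil_zero_right, N_zero, sharp_zero,
      cross_zero_right]⟩
    omega
  obtain ⟨y, hy, hy0⟩ := exists_equivalent_α_ne_zero hC hx
  obtain ⟨z, hz, hz0, hmin⟩ := exists_minimal_abs Freudenthal.α (S := Equivalent x) hy hy0
  have hm : IsMinimal z := ⟨hz0, fun w hw => hmin w (hz.trans hw)⟩
  obtain ⟨D, hD⟩ := hm.exists_B_eq_smul hC
  obtain ⟨E, hE⟩ := hm.exists_A_eq_smul hC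
  -- When `α` divides `A` and `B` it divides `T`, so the hypothesis makes it a unit.
  have habs : z.α.natAbs = 1 := hT _ (by
    obtain ⟨w, hw⟩ := hz.symm.dvdT (dvdT_of_eq_smul hE hD)
    rcases Int.natAbs_eq z.α with h | h
    · exact ⟨w, by rw [← h, hw]⟩
    · exact ⟨-w, by rw [hw, smul_neg, ← neg_smul, ← h]⟩)
  obtain ⟨w, hw, hw1⟩ : ∃ w, Equivalent x w ∧ w.α = 1 := by
    rcases Int.natAbs_eq z.α with h | h
    · exact ⟨z, hz, by omega⟩
    · exact ⟨-z, hz.trans (equivalent_neg z), by rw [neg_α]; omega⟩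
  have hv := hw.trans (equivalent_translate (mem_translations (-w.B)) w)
  have hB : (Freudenthal.translate (-w.B) w).B = 0 := by simp [Freudenthal.translate, hw1]
  have hα : (Freudenthal.translate (-w.B) w).α = 1 := hw1
  generalize Freudenthal.translate (-w.B) w = v at hv hB hα
  obtain ⟨a, g, g', P, ha⟩ := exists_congruent_diag hC v.A
  refine ⟨v.β, a, ?_⟩
  convert hv.trans (equivalent_lift P v) using 1
  ext1
  · exact hα.symm
  · rfl
  · exact ha.symm
  · change 0 = g' v.B
    rw [hB]
    simpa using (P.symm.map_smul 0 0).symm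

end Freudenthal

/-! ### The three composition rings -/

theorem isotropicallyDetected_binarion : IsotropicallyDetected Binarion := fun d z h => by
  have h1 : d ∣ z.1 := by simpa [tr, bar] using h (0, 1) (1, 0) (by simp [nm]) (by simp [tr, bar])
  have h2 : d ∣ z.2 := by simpa [tr, bar] using h (1, 0) (0, 1) (by simp [nm]) (by simp [tr, bar])
  obtain ⟨a, ha⟩ := h1
  obtain ⟨b, hb⟩ := h2
  exact ⟨(a, b), Prod.ext ha hb⟩

theorem quaternion_tr_mul_bar (x y : Quaternion) :
    tr (x * bar y) = x 0 0 * y 1 1 - x 0 1 * y 1 0 - x 1 0 * y 0 1 + x 1 1 * y 0 0 := by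
  simp only [quaternion_tr, Matrix.mul_apply, Fin.sum_univ_two, quaternion_bar_00,
    quaternion_bar_01, quaternion_bar_10, quaternion_bar_11]
  ring

/-- Matrix units are isotropic and read off single entries; each is dual to the opposite unit up to
sign. -/
theorem isotropicallyDetected_quaternion : IsotropicallyDetected Quaternion := fun d z h => by
  have h11 : d ∣ z 0 0 := by
    simpa [quaternion_tr_mul_bar] using h !![0, 0; 0, 1] !![1, 0; 0, 0] (by simp [quaternion_nm])
      (by rw [quaternion_tr_mul_bar]; simp)
  have h22 : d ∣ z 1 1 := by
    simpa [quaternion_tr_mul_bar] using h !![1, 0; 0, 0] !![0, 0; 0, 1] (by simp [quaternion_nm])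
      (by rw [quaternion_tr_mul_bar]; simp)
  have h12 : d ∣ z 0 1 := by
    simpa [quaternion_tr_mul_bar] using h !![0, 0; 1, 0] !![0, -1; 0, 0] (by simp [quaternion_nm])
      (by rw [quaternion_tr_mul_bar]; simp)
  have h21 : d ∣ z 1 0 := by
    simpa [quaternion_tr_mul_bar] using h !![0, 1; 0, 0] !![0, 0; -1, 0] (by simp [quaternion_nm])
      (by rw [quaternion_tr_mul_bar]; simp)
  obtain ⟨a, ha⟩ := h11
  obtain ⟨b, hb⟩ := h12
  obtain ⟨c, hc⟩ := h21
  obtain ⟨e, he⟩ := h22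
  refine ⟨!![a, b; c, e], ?_⟩
  ext i j
  fin_cases i <;> fin_cases j <;> simpa

theorem Octonion.tr_mul_bar (x y : Octonion) :
    tr (x * bar y) = tr (x.a * bar y.a) + tr (x.b * bar y.b) := by
  have h : tr (x * bar y) = tr (x.a * bar y.a - bar (-y.b) * x.b) := rfl
  rw [h, tr_sub, bar_neg, neg_mul, tr_neg, tr_mul_comm (bar y.b)]
  ring

/-- The two quaternion halves are orthogonal for the trace form, so testing each half separately is
enough. -/
theorem isotropicallyDetected_octonion : IsotropicallyDetected Octonion := fun d z h => by
  obtain ⟨a, ha⟩ := isotropicallyDetected_quaternion d z.a fun w u hw hu => by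
    simpa [Octonion.tr_mul_bar, tr_zero'] using h ⟨w, 0⟩ ⟨u, 0⟩
      (by change nm w + nm (0 : Quaternion) = 0; rw [hw, nm_zero', add_zero])
      (by simpa [Octonion.tr_mul_bar, tr_zero'] using hu)
  obtain ⟨b, hb⟩ := isotropicallyDetected_quaternion d z.b fun w u hw hu => by
    simpa [Octonion.tr_mul_bar, tr_zero'] using h ⟨0, w⟩ ⟨0, u⟩
      (by change nm (0 : Quaternion) + nm w = 0; rw [hw, nm_zero', add_zero])
      (by simpa [Octonion.tr_mul_bar, tr_zero'] using hu)
  exact ⟨⟨a, b⟩, Octonion.ext ha hb⟩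

end IntegralFreudenthal

/-! ### Primitive binary forms and the divisors of `T`. -/

namespace IntegralFreudenthal
open CubicLattice

namespace Freudenthal

theorem PrimitiveForm.dvd {a b c d k : ℤ} (h : PrimitiveForm a b c) (ha : d ∣ k * a)
    (hb : d ∣ k * b) (hc : d ∣ k * c) : d ∣ k := by
  have h1 := Int.gcd_eq_gcd_ab (Int.gcd a b) c
  have h2 := Int.gcd_eq_gcd_ab a b
  rw [h, h2] at h1
  have e : k = k * a * (Int.gcdA a b * Int.gcdA (Int.gcd a b) c)
      + k * b * (Int.gcdB a b * Int.gcdA (Int.gcd a b) c)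
      + k * c * Int.gcdB (Int.gcd a b) c := by
    rw [h2]
    push_cast at h1
    linear_combination k * h1
  rw [e]
  exact dvd_add (dvd_add (ha.mul_right _) (hb.mul_right _)) (hc.mul_right _)

theorem primitiveForm_of_forall_dvd {a b c : ℤ}
    (h : ∀ d : ℕ, (d : ℤ) ∣ a → (d : ℤ) ∣ b → (d : ℤ) ∣ c → d = 1) : PrimitiveForm a b c :=
  h _ ((Int.gcd_dvd_left _ _).trans (Int.gcd_dvd_left _ _))
    ((Int.gcd_dvd_left _ _).trans (Int.gcd_dvd_right _ _)) (Int.gcd_dvd_right _ _)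

/-! ### The case `ℤ ⊕ ℤ ⊕ ℤ` -/

/-- Divisibility of `T(x, x, x)` in `M(ℤ ⊕ ℤ ⊕ ℤ)`, in coordinates. -/
theorem dvdT_diag_iff (d : ℤ) (x : Freudenthal Diag) : DvdT d x ↔
    d ∣ -x.α ^ 2 * x.β + x.α * (x.A 0 * x.B 0 + x.A 1 * x.B 1 + x.A 2 * x.B 2) - 2 * (x.B 0 *
        x.B 1 * x.B 2) ∧
    d ∣ x.α * x.β ^ 2 - x.β * (x.A 0 * x.B 0 + x.A 1 * x.B 1 + x.A 2 * x.B 2) + 2 * (x.A 0 * x.A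
        1 * x.A 2) ∧
    d ∣ 2 * (x.A 0 * (x.A 1 * x.B 1 + x.A 2 * x.B 2) - x.β * x.B 1 * x.B 2) - (x.A 0 * x.B 0 +
        x.A 1 * x.B 1 + x.A 2 * x.B 2 - x.α * x.β) * x.A 0 ∧
    d ∣ 2 * (x.A 1 * (x.A 2 * x.B 2 + x.A 0 * x.B 0) - x.β * x.B 2 * x.B 0) - (x.A 0 * x.B 0 +
        x.A 1 * x.B 1 + x.A 2 * x.B 2 - x.α * x.β) * x.A 1 ∧
    d ∣ 2 * (x.A 2 * (x.A 0 * x.B 0 + x.A 1 * x.B 1) - x.β * x.B 0 * x.B 1) - (x.A 0 * x.B 0 +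
        x.A 1 * x.B 1 + x.A 2 * x.B 2 - x.α * x.β) * x.A 2 ∧
    d ∣ 2 * (x.α * x.A 1 * x.A 2 - x.B 0 * (x.A 1 * x.B 1 + x.A 2 * x.B 2)) + (x.A 0 * x.B 0 +
        x.A 1 * x.B 1 + x.A 2 * x.B 2 - x.α * x.β) * x.B 0 ∧
    d ∣ 2 * (x.α * x.A 2 * x.A 0 - x.B 1 * (x.A 2 * x.B 2 + x.A 0 * x.B 0)) + (x.A 0 * x.B 0 +
        x.A 1 * x.B 1 + x.A 2 * x.B 2 - x.α * x.β) * x.B 1 ∧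
    d ∣ 2 * (x.α * x.A 0 * x.A 1 - x.B 2 * (x.A 0 * x.B 0 + x.A 1 * x.B 1)) + (x.A 0 * x.B 0 +
        x.A 1 * x.B 1 + x.A 2 * x.B 2 - x.α * x.β) * x.B 2 := by
  have hA : ∀ i, (tFormula x).A i = ![
      2 * (x.A 0 * (x.A 1 * x.B 1 + x.A 2 * x.B 2) - x.β * x.B 1 * x.B 2) - (x.A 0 * x.B 0 + x.A
          1 * x.B 1 + x.A 2 * x.B 2 - x.α * x.β) * x.A 0,
      2 * (x.A 1 * (x.A 2 * x.B 2 + x.A 0 * x.B 0) - x.β * x.B 2 * x.B 0) - (x.A 0 * x.B 0 + x.A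
          1 * x.B 1 + x.A 2 * x.B 2 - x.α * x.β) * x.A 1,
      2 * (x.A 2 * (x.A 0 * x.B 0 + x.A 1 * x.B 1) - x.β * x.B 0 * x.B 1) - (x.A 0 * x.B 0 + x.A
          1 * x.B 1 + x.A 2 * x.B 2 - x.α * x.β) * x.A 2] i := fun i => by
    simp only [tFormula, cross, sharp, bil, Pi.sub_apply, Pi.add_apply, Pi.smul_apply,
      smul_eq_mul]
    fin_cases i <;> simp <;> ring
  have hB : ∀ i, (tFormula x).B i = ![
      2 * (x.α * x.A 1 * x.A 2 - x.B 0 * (x.A 1 * x.B 1 + x.A 2 * x.B 2)) + (x.A 0 * x.B 0 + x.A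
          1 * x.B 1 + x.A 2 * x.B 2 - x.α * x.β) * x.B 0,
      2 * (x.α * x.A 2 * x.A 0 - x.B 1 * (x.A 2 * x.B 2 + x.A 0 * x.B 0)) + (x.A 0 * x.B 0 + x.A
          1 * x.B 1 + x.A 2 * x.B 2 - x.α * x.β) * x.B 1,
      2 * (x.α * x.A 0 * x.A 1 - x.B 2 * (x.A 0 * x.B 0 + x.A 1 * x.B 1)) + (x.A 0 * x.B 0 + x.A
          1 * x.B 1 + x.A 2 * x.B 2 - x.α * x.β) * x.B 2] i := fun i => by
    simp only [tFormula, cross, sharp, bil, Pi.sub_apply, Pi.add_apply, Pi.smul_apply,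
      smul_eq_mul]
    fin_cases i <;> simp <;> ring
  constructor
  · rintro ⟨y, hy⟩
    have hA' : ∀ i, d ∣ (tFormula x).A i := fun i => hy ▸ ⟨y.A i, rfl⟩
    have hB' : ∀ i, d ∣ (tFormula x).B i := fun i => hy ▸ ⟨y.B i, rfl⟩
    simp only [hA, hB] at hA' hB'
    exact ⟨⟨y.α, congrArg Freudenthal.α hy⟩, ⟨y.β, congrArg Freudenthal.β hy⟩,
      hA' 0, hA' 1, hA' 2, hB' 0, hB' 1, hB' 2⟩
  · rintro ⟨⟨a, ha⟩, ⟨b, hb⟩, ⟨a0, h0⟩, ⟨a1, h1⟩, ⟨a2, h2⟩, ⟨b0, k0⟩, ⟨b1, k1⟩, ⟨b2, k2⟩⟩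
    refine ⟨⟨a, b, ![a0, a1, a2], ![b0, b1, b2]⟩, Freudenthal.ext ha hb ?_ ?_⟩
    · ext i
      rw [hA]
      fin_cases i
      exacts [h0, h1, h2]
    · ext i
      rw [hB]
      fin_cases i
      exacts [k0, k1, k2]

/-- The coefficients of each of the three binary quadratic forms generate an ideal containing
the coordinates of `T(x, x, x)`. -/
theorem isProjectiveDiag_of_forall_dvdT {x : Freudenthal Diag}
    (h : ∀ d : ℕ, DvdT d x → d = 1) : IsProjectiveDiag x := by
  refine ⟨?_, ?_, ?_⟩ <;>
    refine primitiveForm_of_forall_dvd fun d ⟨u, hu⟩ ⟨v, hv⟩ ⟨w, hw⟩ =>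
      h d ((dvdT_diag_iff _ _).2 ?_)
  -- Each witness is, up to sign, half a partial derivative of the discriminant: the middle
  -- coefficient enters once and the outer ones doubled.
  · exact ⟨⟨x.α * v + 2 * x.B 0 * u, by linear_combination x.α * hv + 2 * x.B 0 * hu⟩,
      ⟨-x.β * v - 2 * x.A 0 * w, by linear_combination -x.β * hv - 2 * x.A 0 * hw⟩,
      ⟨2 * x.β * u + x.A 0 * v, by linear_combination 2 * x.β * hu + x.A 0 * hv⟩,
      ⟨-x.A 1 * v - 2 * x.B 2 * w, by linear_combination -x.A 1 * hv - 2 * x.B 2 * hw⟩,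
      ⟨-x.A 2 * v - 2 * x.B 1 * w, by linear_combination -x.A 2 * hv - 2 * x.B 1 * hw⟩,
      ⟨-2 * x.α * w - x.B 0 * v, by linear_combination -2 * x.α * hw - x.B 0 * hv⟩,
      ⟨2 * x.A 2 * u + x.B 1 * v, by linear_combination 2 * x.A 2 * hu + x.B 1 * hv⟩,
      ⟨2 * x.A 1 * u + x.B 2 * v, by linear_combination 2 * x.A 1 * hu + x.B 2 * hv⟩⟩
  · exact ⟨⟨x.α * v + 2 * x.B 1 * u, by linear_combination x.α * hv + 2 * x.B 1 * hu⟩,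
      ⟨-x.β * v - 2 * x.A 1 * w, by linear_combination -x.β * hv - 2 * x.A 1 * hw⟩,
      ⟨-x.A 0 * v - 2 * x.B 2 * w, by linear_combination -x.A 0 * hv - 2 * x.B 2 * hw⟩,
      ⟨2 * x.β * u + x.A 1 * v, by linear_combination 2 * x.β * hu + x.A 1 * hv⟩,
      ⟨-x.A 2 * v - 2 * x.B 0 * w, by linear_combination -x.A 2 * hv - 2 * x.B 0 * hw⟩,
      ⟨2 * x.A 2 * u + x.B 0 * v, by linear_combination 2 * x.A 2 * hu + x.B 0 * hv⟩,
      ⟨-2 * x.α * w - x.B 1 * v, by linear_combination -2 * x.α * hw - x.B 1 * hv⟩,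
      ⟨2 * x.A 0 * u + x.B 2 * v, by linear_combination 2 * x.A 0 * hu + x.B 2 * hv⟩⟩
  · exact ⟨⟨x.α * v + 2 * x.B 2 * u, by linear_combination x.α * hv + 2 * x.B 2 * hu⟩,
      ⟨-x.β * v - 2 * x.A 2 * w, by linear_combination -x.β * hv - 2 * x.A 2 * hw⟩,
      ⟨-x.A 0 * v - 2 * x.B 1 * w, by linear_combination -x.A 0 * hv - 2 * x.B 1 * hw⟩,
      ⟨-x.A 1 * v - 2 * x.B 0 * w, by linear_combination -x.A 1 * hv - 2 * x.B 0 * hw⟩,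
      ⟨2 * x.β * u + x.A 2 * v, by linear_combination 2 * x.β * hu + x.A 2 * hv⟩,
      ⟨2 * x.A 1 * u + x.B 0 * v, by linear_combination 2 * x.A 1 * hu + x.B 0 * hv⟩,
      ⟨2 * x.A 0 * u + x.B 1 * v, by linear_combination 2 * x.A 0 * hu + x.B 1 * hv⟩,
      ⟨-2 * x.α * w - x.B 2 * v, by linear_combination -2 * x.α * hw - x.B 2 * hv⟩⟩

/-- The products of the coefficients of two of the three binary quadratic forms, doubled, lie in
the ideal generated by the coordinates of `T(x, x, x)`. -/
theorem IsProjectiveDiag.dvd_two {x : Freudenthal Diag} (h : IsProjectiveDiag x) {d : ℤ}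
    (hd : DvdT d x) : d ∣ 2 := by
  obtain ⟨⟨t, ht⟩, ⟨u, hu⟩, ⟨a0, ha0⟩, ⟨a1, ha1⟩, ⟨a2, ha2⟩, ⟨b0, hb0⟩, ⟨b1, hb1⟩, ⟨b2, hb2⟩⟩ :=
    (dvdT_diag_iff _ _).1 hd
  obtain ⟨h1, h2, -⟩ := h
  -- Bézout for two forms reduces `d ∣ 2` to the nine doubled products of their coefficients.
  refine h1.dvd ?_ ?_ ?_ <;> refine h2.dvd ?_ ?_ ?_
  · exact ⟨-x.B 2 * t + x.α * b2,
      by linear_combination -x.B 2 * ht + x.α * hb2⟩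
  · exact ⟨-2 * x.α * a0 + 2 * x.B 2 * b1,
      by linear_combination -2 * x.α * ha0 + 2 * x.B 2 * hb1⟩
  · exact ⟨x.B 1 * a0 - x.A 0 * b1,
      by linear_combination x.B 1 * ha0 - x.A 0 * hb1⟩
  · exact ⟨2 * x.B 2 * b0 - 2 * x.α * a1,
      by linear_combination 2 * x.B 2 * hb0 - 2 * x.α * ha1⟩
  · exact ⟨-2 * x.β * t + 2 * x.B 0 * a0 + 2 * x.B 1 * a1 - 2 * x.B 2 * a2,
      by linear_combination -2 * x.β * ht + 2 * x.B 0 * ha0 + 2 * x.B 1 * ha1 - 2 * x.B 2 * ha2⟩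
  · exact ⟨-2 * x.A 2 * a0 + 2 * x.β * b1,
      by linear_combination -2 * x.A 2 * ha0 + 2 * x.β * hb1⟩
  · exact ⟨-x.A 1 * b0 + x.B 0 * a1,
      by linear_combination -x.A 1 * hb0 + x.B 0 * ha1⟩
  · exact ⟨2 * x.β * b0 - 2 * x.A 2 * a1,
      by linear_combination 2 * x.β * hb0 - 2 * x.A 2 * ha1⟩
  · exact ⟨x.A 2 * u - x.β * a2,
      by linear_combination x.A 2 * hu - x.β * ha2⟩

/-! ### Hermitian matrices -/

open Herm

variable {C : Type} [NonUnitalNonAssocRing C]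

/-- The diagonal embedding of `M(ℤ ⊕ ℤ ⊕ ℤ)`. -/
def ofDiag (C : Type) [NonUnitalNonAssocRing C] (x : Freudenthal Diag) : Freudenthal (Herm C) :=
  ⟨x.α, x.β, diag x.A, diag x.B⟩

theorem ofDiag_mk (α β : ℤ) (a : Diag) :
    ofDiag C ⟨α, β, a, 0⟩ = ⟨α, β, diag a, 0⟩ := by
  ext1
  · rfl
  · rfl
  · rfl
  · ext1 <;> rfl

theorem diag_add (a b : Diag) : (diag (a + b) : Herm C) = diag a + diag b := by
  ext1 <;> simp [diag]

theorem diag_sub (a b : Diag) : (diag (a - b) : Herm C) = diag a - diag b := by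
  ext1 <;> simp [diag]

theorem diag_smul (k : ℤ) (a : Diag) : (diag (k • a) : Herm C) = k • diag a := by
  ext1 <;> simp [diag]

variable [CompositionRing C]

theorem sharp_diag (a : Diag) : sharp (diag a : Herm C) = diag (sharp a) := by
  ext1 <;> simp [diag, sharp, nm_zero']
  ring

theorem cross_diag (a b : Diag) : cross (diag a : Herm C) (diag b) = diag (cross a b) := by
  unfold cross
  rw [← diag_add, sharp_diag, sharp_diag, sharp_diag, diag_sub, diag_sub]

theorem bil_diag (a b : Diag) : bil (diag a : Herm C) (diag b) = bil a b := by
  simp [diag, bil, tr_zero']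

theorem N_diag (a : Diag) : N (diag a : Herm C) = N a := by
  simp [diag, N, nm_zero', tr_zero']

theorem tFormula_ofDiag (x : Freudenthal Diag) :
    tFormula (ofDiag C x) = ofDiag C (tFormula x) := by
  ext1 <;> simp only [tFormula, ofDiag, bil_diag, N_diag, sharp_diag, cross_diag, diag_add,
    diag_sub, diag_smul]

theorem dvdT_ofDiag_iff {d : ℤ} {x : Freudenthal Diag} : DvdT d (ofDiag C x) ↔ DvdT d x := by
  constructor
  · rintro ⟨y, hy⟩
    rw [tFormula_ofDiag] at hy
    have hα : (tFormula x).α = d * y.α := congrArg Freudenthal.α hy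
    have hβ : (tFormula x).β = d * y.β := congrArg Freudenthal.β hy
    have hA := congrArg Freudenthal.A hy
    have hB := congrArg Freudenthal.B hy
    refine ⟨⟨y.α, y.β, ![y.A.a, y.A.b, y.A.c], ![y.B.a, y.B.b, y.B.c]⟩,
      Freudenthal.ext hα hβ ?_ ?_⟩
    · ext i
      fin_cases i
      exacts [congrArg Herm.a hA, congrArg Herm.b hA, congrArg Herm.c hA]
    · ext i
      fin_cases i
      exacts [congrArg Herm.a hB, congrArg Herm.b hB, congrArg Herm.c hB]
  · rintro ⟨y, hy⟩
    refine ⟨ofDiag C y, ?_⟩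
    rw [tFormula_ofDiag, hy]
    ext1
    · rfl
    · rfl
    · exact diag_smul d y.A
    · exact diag_smul d y.B

theorem IsProjective.dvd_two {x : Freudenthal (Herm C)} (h : IsProjective x) {d : ℤ}
    (hd : DvdT d x) : d ∣ 2 := by
  obtain ⟨α, β, a, -, -, -, hx, h⟩ := h
  have hd' := Equivalent.dvdT hx hd
  rw [← ofDiag_mk, dvdT_ofDiag_iff] at hd'
  exact h.dvd_two hd'

/-- The reduction gives `α = 1`, so the divisibility conditions are automatic, and primitivity is
the diagonal case applied to the same divisors of `T`. -/
theorem isProjective_of_forall_dvdT (hC : IsotropicallyDetected C) {x : Freudenthal (Herm C)}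
    (h : ∀ d : ℕ, DvdT d x → d = 1) : IsProjective x := by
  obtain ⟨β, a, hx⟩ := exists_equivalent_diag hC h
  refine ⟨1, β, a, one_pos, one_dvd _, fun _ => one_dvd _, hx,
    isProjectiveDiag_of_forall_dvdT fun d hd => h d (hx.symm.dvdT ?_)⟩
  rwa [← ofDiag_mk, dvdT_ofDiag_iff]

/-- Any notion of projectivity that follows from `gcd T(x, x, x) = 1` and allows only divisors of
`2` in `T(x, x, x)` obeys the trichotomy in terms of `gcd T(x, x, x)`. -/
theorem gcd_T_trichotomy {J : Type} [AddCommGroup J] [CubicLattice J] {x : Freudenthal J}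
    {P : Prop} (h1 : (∀ d : ℕ, DvdT d x → d = 1) → P) (h2 : P → ∀ d : ℤ, DvdT d x → d ∣ 2) :
    (x.T.gcd = 1 → P) ∧ (3 ≤ x.T.gcd ∨ x.T = 0 → ¬ P) ∧ (Odd x.q' → (x.T.gcd = 1 ↔ P)) := by
  have h3 : x.T.gcd = 1 → P := fun h => h1 fun d hd => eq_one_of_dvdT h hd
  refine ⟨h3, fun h hP => ?_, fun hq => ⟨h3, fun hP => gcd_T_eq_one fun d hd => ?_⟩⟩
  · obtain ⟨d, hd3, hd⟩ := exists_dvdT_of_three_le h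
    have := Int.le_of_dvd two_pos (h2 hP d hd)
    omega
  · rcases (Nat.dvd_prime Nat.prime_two).1 (Int.natCast_dvd_natCast.1 (h2 hP d hd)) with h | rfl
    · exact h
    · exact absurd hd (not_two_dvdT hq)

theorem gcd_T_trichotomy_herm (hC : IsotropicallyDetected C) (x : Freudenthal (Herm C)) :
    (x.T.gcd = 1 → x.IsProjective) ∧ (3 ≤ x.T.gcd ∨ x.T = 0 → ¬ x.IsProjective) ∧
      (Odd x.q' → (x.T.gcd = 1 ↔ x.IsProjective)) :=
  gcd_T_trichotomy (isProjective_of_forall_dvdT hC) fun h _ hd => h.dvd_two hd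

end Freudenthal

end IntegralFreudenthal

/-- The greatest common divisor of the coordinates of `T(x, x, x)` detects projectivity, for
`ℤ ⊕ ℤ ⊕ ℤ` and for Hermitian matrices over the integral split binarions, quaternions and
octonions. -/
theorem proposition4 :
    (∀ x : IntegralFreudenthal.Freudenthal IntegralFreudenthal.Diag,
      (x.T.gcd = 1 → x.IsProjectiveDiag) ∧
      (3 ≤ x.T.gcd ∨ x.T = 0 → ¬ x.IsProjectiveDiag) ∧
      (Odd x.q' → (x.T.gcd = 1 ↔ x.IsProjectiveDiag))) ∧
    (∀ x : IntegralFreudenthal.Freudenthal (IntegralFreudenthal.Herm IntegralFreudenthal.Binarion),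
      (x.T.gcd = 1 → x.IsProjective) ∧
      (3 ≤ x.T.gcd ∨ x.T = 0 → ¬ x.IsProjective) ∧
      (Odd x.q' → (x.T.gcd = 1 ↔ x.IsProjective))) ∧
    (∀ x : IntegralFreudenthal.Freudenthal
        (IntegralFreudenthal.Herm IntegralFreudenthal.Quaternion),
      (x.T.gcd = 1 → x.IsProjective) ∧
      (3 ≤ x.T.gcd ∨ x.T = 0 → ¬ x.IsProjective) ∧
      (Odd x.q' → (x.T.gcd = 1 ↔ x.IsProjective))) ∧
    (∀ x : IntegralFreudenthal.Freudenthal (IntegralFreudenthal.Herm IntegralFreudenthal.Octonion),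
      (x.T.gcd = 1 → x.IsProjective) ∧
      (3 ≤ x.T.gcd ∨ x.T = 0 → ¬ x.IsProjective) ∧
      (Odd x.q' → (x.T.gcd = 1 ↔ x.IsProjective))) := by
  exact ⟨fun _ => IntegralFreudenthal.Freudenthal.gcd_T_trichotomy
      IntegralFreudenthal.Freudenthal.isProjectiveDiag_of_forall_dvdT fun h _ hd => h.dvd_two hd,
    IntegralFreudenthal.Freudenthal.gcd_T_trichotomy_herm
      IntegralFreudenthal.isotropicallyDetected_binarion,
    IntegralFreudenthal.Freudenthal.gcd_T_trichotomy_herm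
      IntegralFreudenthal.isotropicallyDetected_quaternion,
    IntegralFreudenthal.Freudenthal.gcd_T_trichotomy_herm
      IntegralFreudenthal.isotropicallyDetected_octonion⟩
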